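/- **Setting.** Let $\Omega=(a,b)\times(c,d)\subset\mathbb R^2$ be tessellated by the rectangular cells $\Omega_{ij}=I_i\times J_j$, $I_i=(x_{i-1/2},x_{i+1/2})$, $J_j=(y_{j-1/2},y_{j+1/2})$, $1\le i\le N_x$, $1\le j\le N_y$, let $k\ge 0$, and let $V_h^k$ be the space of functions whose restriction to every $\Omega_{ij}$ is a polynomial of degree at most $k$ in each variable. Write $(\cdot,\cdot)_{\Omega_{ij}}$ for the $L^2(\Omega_{ij})$ inner product, $\|\cdot\|$ for the $L^2(\Omega)$ norm, $\boldsymbol n$ for the outward unit normal of $\partial\Omega_{ij}$, and $v^{-},v^{+}$ for the traces of $v$ on a vertical (horizontal) edge from the left and right (from below and above), with periodic continuation across $\partial\Omega$. Let $\sigma_1,\sigma_2\in\mathbb R\setminus\{1/2\}$; the numerical fluxes are $\widehat u=\sigma_1u^-+(1-\sigma_1)u^+$, $\widehat{\boldsymbol p}=(1-\sigma_1)\boldsymbol p^-+\sigma_1\boldsymbol p^+$ on vertical edges, and the same with $\sigma_2$ on horizontal edges. Let $0<\alpha<1$, $T>0$, let $\kappa:\Omega\to\mathbb R$ be bounded and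 measurable, and $u_0\in L^2(\Omega)$. Put $${}_0^CD_t^{\alpha,\kappa}u(t)=\frac{e^{-\kappa t}}{\Gamma(1-\alpha)}\int_0^t(t-s)^{-\alpha}\,\partial_s\big(e^{\kappa s}u(s)\big)\,ds .$$ *Semi-discrete scheme.* $u_h:[0,T]\to V_h^k$ is continuous, $\boldsymbol p_h:(0,T]\to (V_h^k)^2$, and for all $t\in(0,T]$, all cells and all $v\in V_h^k$, $\boldsymbol w\in (V_h^k)^2$, $$({}_0^CD_t^{\alpha,\kappa}u_h,v)_{\Omega_{ij}}+(\boldsymbol p_h,\nabla v)_{\Omega_{ij}}-\langle\widehat{\boldsymbol p_h}\cdot\boldsymbol n,v\rangle_{\partial\Omega_{ij}}=0,\qquad (\boldsymbol p_h,\boldsymbol w)_{\Omega_{ij}}+(u_h,\nabla\cdot\boldsymbol w)_{\Omega_{ij}}-\langle\widehat{u_h},\boldsymbol w\cdot\boldsymbol n\rangle_{\partial\Omega_{ij}}=0,$$ and $(u_h(0),v)_{\Omega_{ij}}=(u_0,v)_{\Omega_{ij}}$. *Fully discrete scheme.* Let $\gamma\ge1$, and for $M\ge 1$ let $t_n=(n/M)^\gamma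 T$ ($0\le n\le M$), $\tau_n=t_n-t_{n-1}$, $\tau=\max_{1\le n\le M}\tau_n$, and $$A_{i-1}^n=\frac{(t_n-t_{n-i})^{1-\alpha}-(t_n-t_{n-i+1})^{1-\alpha}}{\Gamma(2-\alpha)\,\tau_{n-i+1}},\quad 1\le i\le n,$$ $${}^CD_M^{\alpha,\kappa}u^n=A_0^nu^n-A_{n-1}^ne^{-\kappa t_n}u^0+\sum_{i=1}^{n-1}(A_i^n-A_{i-1}^n)e^{-\kappa(t_n-t_{n-i})}u^{n-i}.$$ Then $u_h^n\in V_h^k$ ($0\le n\le M$) and $\boldsymbol p_h^n\in (V_h^k)^2$ ($1\le n\le M$) solve the two equations above for $n=1,\dots,M$, with ${}^CD_M^{\alpha,\kappa}u_h^n,\ u_h^n,\ \boldsymbol p_h^n$ in place of ${}_0^CD_t^{\alpha,\kappa}u_h,\ u_h,\ \boldsymbol p_h$, and $(u_h^0,v)_{\Omega_{ij}}=(u_0,v)_{\Omega_{ij}}$. **Theorem.** Let $\delta\in(0,1)\cup(1,2)$ and suppose that the semi-discrete solution $u_h$ lies in $C^2_\delta((0,T];V_h^k)$, that is, $u_h\in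 C^2((0,T];V_h^k)$ and there is $C_u$ with $\|u_h^{(l)}(t)\|\le C_u(1+t^{\delta-l})$ for $l=1,2$ and $0<t\le T$. Then there is a constant $C>0$, independent of $M$ (hence of $\tau$) and of $n$, such that for every $M\ge1$ and every fully discrete solution $(u_h^n,\boldsymbol p_h^n)$, $$\|u_h(t_n)-u_h^n\|\le C\,\tau^{\min\{2-\alpha,\ \gamma\delta\}},\qquad n=1,\dots,M .$$ -/

import Mathlib

open Set MeasureTheory

noncomputable section

namespace FeynmanKacLDG

/-! ### Rectangular meshes and broken polynomial spaces -/

/-- A rectangular tessellation of an open rectangle into `Nx × Ny` cells. The nodes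
`x 0 < x 1 < ⋯ < x Nx` are the points `x_{1/2}, …, x_{Nx+1/2}`, and similarly for `y`. -/
structure RectMesh (Nx Ny : ℕ) where
  x : Fin (Nx + 1) → ℝ
  y : Fin (Ny + 1) → ℝ
  x_strictMono : StrictMono x
  y_strictMono : StrictMono y

namespace RectMesh

variable {Nx Ny : ℕ} (m : RectMesh Nx Ny)

/-- The rectangle that is tessellated. -/
def domain : Set (ℝ × ℝ) :=
  Ioo (m.x 0) (m.x (Fin.last Nx)) ×ˢ Ioo (m.y 0) (m.y (Fin.last Ny))

/-- Left end point of the `i`-th interval in the first variable. -/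
def xl (i : Fin Nx) : ℝ := m.x i.castSucc

/-- Right end point of the `i`-th interval in the first variable. -/
def xr (i : Fin Nx) : ℝ := m.x i.succ

/-- Lower end point of the `j`-th interval in the second variable. -/
def yl (j : Fin Ny) : ℝ := m.y j.castSucc

/-- Upper end point of the `j`-th interval in the second variable. -/
def yr (j : Fin Ny) : ℝ := m.y j.succ

/-- The open cell `Ω_{ij} = I_i × J_j`. -/
def cell (i : Fin Nx) (j : Fin Ny) : Set (ℝ × ℝ) :=
  Ioo (m.xl i) (m.xr i) ×ˢ Ioo (m.yl j) (m.yr j)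

/-- The `L²` pairing `(f, g)_{Ω_{ij}}` on a cell. -/
def cellInner (i : Fin Nx) (j : Fin Ny) (f g : ℝ × ℝ → ℝ) : ℝ :=
  ∫ z in m.cell i j, f z * g z

end RectMesh

/-- Polynomials of degree at most `k` in each of the two variables (the tensor product space
`Q^k = P^k ⊗ P^k`), given by their coefficients: `c a b` is the coefficient of `x^a y^b`. -/
abbrev LocalQ (k : ℕ) : Type := Fin (k + 1) → Fin (k + 1) → ℝ

/-- The value of a polynomial in `Q^k` at a point. -/
def LocalQ.eval {k : ℕ} (c : LocalQ k) (z : ℝ × ℝ) : ℝ :=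
  ∑ a : Fin (k + 1), ∑ b : Fin (k + 1), c a b * z.1 ^ (a : ℕ) * z.2 ^ (b : ℕ)

/-- The partial derivative in the first variable. -/
def LocalQ.dx {k : ℕ} (c : LocalQ k) (z : ℝ × ℝ) : ℝ := deriv (fun s => c.eval (s, z.2)) z.1

/-- The partial derivative in the second variable. -/
def LocalQ.dy {k : ℕ} (c : LocalQ k) (z : ℝ × ℝ) : ℝ := deriv (fun s => c.eval (z.1, s)) z.2

/-- The space `V_h^k` of piecewise polynomials: one polynomial of `Q^k` for every cell, with no
continuity across cells. It is a finite dimensional real vector space and carries its usual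
topology. -/
abbrev DGSpace (Nx Ny k : ℕ) : Type := Fin Nx → Fin Ny → LocalQ k

section

variable {Nx Ny k : ℕ} (m : RectMesh Nx Ny)

/-- The `L²(Ω)` norm on `V_h^k`, `‖v‖ = (∑_{ij} ‖v‖²_{Ω_{ij}})^{1/2}`. -/
def dgNorm (v : DGSpace Nx Ny k) : ℝ :=
  Real.sqrt (∑ i : Fin Nx, ∑ j : Fin Ny, m.cellInner i j (v i j).eval (v i j).eval)

variable [NeZero Nx] [NeZero Ny]

/-- The weighted average `σ v⁻ + (1 - σ) v⁺` on the right edge `x = x_{i+1/2}` of the cell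
`Ω_{ij}`, at height `s`. `v⁻` is the trace from `Ω_{ij}`, and `v⁺` the trace from the next cell to
the right. Addition in `Fin Nx` is cyclic, which is the periodic boundary condition. -/
def avgX (σ : ℝ) (v : DGSpace Nx Ny k) (i : Fin Nx) (j : Fin Ny) (s : ℝ) : ℝ :=
  σ * (v i j).eval (m.xr i, s) + (1 - σ) * (v (i + 1) j).eval (m.xl (i + 1), s)

/-- The weighted average `σ v⁻ + (1 - σ) v⁺` on the upper edge `y = y_{j+1/2}` of the cell
`Ω_{ij}`, at abscissa `s`, again with periodic continuation. -/
def avgY (σ : ℝ) (v : DGSpace Nx Ny k) (i : Fin Nx) (j : Fin Ny) (s : ℝ) : ℝ :=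
  σ * (v i j).eval (s, m.yr j) + (1 - σ) * (v i (j + 1)).eval (s, m.yl (j + 1))

/-- The boundary term on `∂Ω_{ij}` of the second scheme equation, `⟨û, w · n⟩_{∂Ω_{ij}}`, where
`w = (w₁, w₂)`, `n` is the outward unit normal, `w` is evaluated from inside the cell, and `û` is the
flux with weights `σ₁` (vertical edges) and `σ₂` (horizontal edges). The left edge of the cell `i`
is the right edge of the cell `i - 1` (cyclically). -/
def bdryU (σ₁ σ₂ : ℝ) (u : DGSpace Nx Ny k) (w : DGSpace Nx Ny k × DGSpace Nx Ny k)
    (i : Fin Nx) (j : Fin Ny) : ℝ :=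
  (∫ s in (m.yl j)..(m.yr j),
      (avgX m σ₁ u i j s * (w.1 i j).eval (m.xr i, s)
        - avgX m σ₁ u (i - 1) j s * (w.1 i j).eval (m.xl i, s)))
    + ∫ s in (m.xl i)..(m.xr i),
      (avgY m σ₂ u i j s * (w.2 i j).eval (s, m.yr j)
        - avgY m σ₂ u i (j - 1) s * (w.2 i j).eval (s, m.yl j))

/-- The boundary term on `∂Ω_{ij}` of the first scheme equation, `⟨p̂ · n, v⟩_{∂Ω_{ij}}`; the flux
`p̂` has the complementary weights `1 - σ₁` and `1 - σ₂`. -/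
def bdryP (σ₁ σ₂ : ℝ) (p : DGSpace Nx Ny k × DGSpace Nx Ny k) (v : DGSpace Nx Ny k)
    (i : Fin Nx) (j : Fin Ny) : ℝ :=
  (∫ s in (m.yl j)..(m.yr j),
      (avgX m (1 - σ₁) p.1 i j s * (v i j).eval (m.xr i, s)
        - avgX m (1 - σ₁) p.1 (i - 1) j s * (v i j).eval (m.xl i, s)))
    + ∫ s in (m.xl i)..(m.xr i),
      (avgY m (1 - σ₂) p.2 i j s * (v i j).eval (s, m.yr j)
        - avgY m (1 - σ₂) p.2 i (j - 1) s * (v i j).eval (s, m.yl j))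

/-- First equation of the local discontinuous Galerkin scheme on all cells, `D` standing for the
(continuous or discrete) fractional time derivative of `u`:
`(D, v)_{Ω_{ij}} + (p, ∇v)_{Ω_{ij}} - ⟨p̂ · n, v⟩_{∂Ω_{ij}} = 0` for all test functions `v`.
`D i j` is the restriction of that derivative to the cell `Ω_{ij}`. -/
def SchemeEq1 (σ₁ σ₂ : ℝ) (D : Fin Nx → Fin Ny → ℝ × ℝ → ℝ)
    (p : DGSpace Nx Ny k × DGSpace Nx Ny k) : Prop :=
  ∀ (v : DGSpace Nx Ny k) (i : Fin Nx) (j : Fin Ny),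
    m.cellInner i j (D i j) (v i j).eval
      + (m.cellInner i j (p.1 i j).eval (v i j).dx + m.cellInner i j (p.2 i j).eval (v i j).dy)
      - bdryP m σ₁ σ₂ p v i j = 0

/-- Second equation of the scheme on all cells:
`(p, w)_{Ω_{ij}} + (u, ∇ · w)_{Ω_{ij}} - ⟨û, w · n⟩_{∂Ω_{ij}} = 0` for all test functions `w`. -/
def SchemeEq2 (σ₁ σ₂ : ℝ) (u : DGSpace Nx Ny k)
    (p : DGSpace Nx Ny k × DGSpace Nx Ny k) : Prop :=
  ∀ (w : DGSpace Nx Ny k × DGSpace Nx Ny k) (i : Fin Nx) (j : Fin Ny),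
    (m.cellInner i j (p.1 i j).eval (w.1 i j).eval
        + m.cellInner i j (p.2 i j).eval (w.2 i j).eval)
      + m.cellInner i j (u i j).eval (fun z => (w.1 i j).dx z + (w.2 i j).dy z)
      - bdryU m σ₁ σ₂ u w i j = 0

/-- The discrete initial condition `(u, v)_{Ω_{ij}} = (u₀, v)_{Ω_{ij}}` for all test functions. -/
def SchemeInit (u₀ : ℝ × ℝ → ℝ) (u : DGSpace Nx Ny k) : Prop :=
  ∀ (v : DGSpace Nx Ny k) (i : Fin Nx) (j : Fin Ny),
    m.cellInner i j (u i j).eval (v i j).eval = m.cellInner i j u₀ (v i j).eval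

end

/-! ### Fractional derivatives in time -/

/-- The Caputo derivative of order `α ∈ (0,1)`. -/
def caputo (α : ℝ) (f : ℝ → ℝ) (t : ℝ) : ℝ :=
  1 / Real.Gamma (1 - α) * ∫ s in (0 : ℝ)..t, (t - s) ^ (-α) * deriv f s

/-- The Caputo fractional substantial derivative `e^{-κt} D^α (e^{κt} f)`, at a point of space
where the potential has the value `κ`. -/
def caputoSubst (α κ : ℝ) (f : ℝ → ℝ) (t : ℝ) : ℝ :=
  Real.exp (-κ * t) * caputo α (fun s => Real.exp (κ * s) * f s) t

/-- The graded mesh `t_n = (n/M)^γ T`. -/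
def gradedTime (T γ : ℝ) (M n : ℕ) : ℝ := ((n : ℝ) / (M : ℝ)) ^ γ * T

/-- The maximal step size `max_{1 ≤ i ≤ M} (t_i - t_{i-1})` of the graded mesh (for `M ≥ 1`). -/
def maxStep (T γ : ℝ) (M : ℕ) : ℝ :=
  ⨆ i : Fin M, (gradedTime T γ M ((i : ℕ) + 1) - gradedTime T γ M (i : ℕ))

/-- The coefficients `A_i^n`, `0 ≤ i ≤ n - 1`, of the L1 formula on the time mesh `t`. -/
def l1Coeff (α : ℝ) (t : ℕ → ℝ) (n i : ℕ) : ℝ :=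
  ((t n - t (n - i - 1)) ^ (1 - α) - (t n - t (n - i)) ^ (1 - α))
    / (Real.Gamma (2 - α) * (t (n - i) - t (n - i - 1)))

/-- The L1 approximation at time `t n`, `n ≥ 1`, of the Caputo fractional substantial derivative,
applied to the values `f 0, …, f n`, at a point of space where the potential has the value `κ`. -/
def l1Subst (α κ : ℝ) (t : ℕ → ℝ) (n : ℕ) (f : ℕ → ℝ) : ℝ :=
  l1Coeff α t n 0 * f n - l1Coeff α t n (n - 1) * Real.exp (-κ * t n) * f 0
    + ∑ i ∈ Finset.Ico 1 n,
        (l1Coeff α t n i - l1Coeff α t n (i - 1))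
          * Real.exp (-κ * (t n - t (n - i))) * f (n - i)

/-! ### The semi-discrete and the fully discrete scheme -/

section

variable {Nx Ny k : ℕ} [NeZero Nx] [NeZero Ny]

/-- `(u, p)` solves the spatial semi-discrete scheme on `(0,T]`, with initial datum `u₀`. -/
structure IsSemiDiscreteSolution (m : RectMesh Nx Ny) (σ₁ σ₂ α T : ℝ) (κ u₀ : ℝ × ℝ → ℝ)
    (u : ℝ → DGSpace Nx Ny k) (p : ℝ → DGSpace Nx Ny k × DGSpace Nx Ny k) : Prop where
  continuousOn : ContinuousOn u (Icc 0 T)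
  eq1 : ∀ t ∈ Ioc 0 T, SchemeEq1 m σ₁ σ₂
    (fun i j z => caputoSubst α (κ z) (fun s => (u s i j).eval z) t) (p t)
  eq2 : ∀ t ∈ Ioc 0 T, SchemeEq2 m σ₁ σ₂ (u t) (p t)
  init : SchemeInit m u₀ (u 0)

/-- `(u n, p n)`, `n ≤ M`, solves the fully discrete scheme on the graded mesh with `M` steps
(`p 0` plays no role). -/
structure IsFullyDiscreteSolution (m : RectMesh Nx Ny) (σ₁ σ₂ α T γ : ℝ) (M : ℕ)
    (κ u₀ : ℝ × ℝ → ℝ)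
    (u : ℕ → DGSpace Nx Ny k) (p : ℕ → DGSpace Nx Ny k × DGSpace Nx Ny k) : Prop where
  eq1 : ∀ n : ℕ, 1 ≤ n → n ≤ M → SchemeEq1 m σ₁ σ₂
    (fun i j z => l1Subst α (κ z) (gradedTime T γ M) n (fun l => (u l i j).eval z)) (p n)
  eq2 : ∀ n : ℕ, 1 ≤ n → n ≤ M → SchemeEq2 m σ₁ σ₂ (u n) (p n)
  init : SchemeInit m u₀ (u 0)

/-- The class `C_δ²((0,T]; V_h^k)`: twice continuously differentiable on `(0,T]` with
`‖u^{(l)}(t)‖ ≤ C_u (1 + t^{δ-l})` for `l = 1, 2`. -/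
def MemC2Delta (m : RectMesh Nx Ny) (δ T : ℝ) (u : ℝ → DGSpace Nx Ny k) : Prop :=
  ContDiffOn ℝ 2 u (Ioc 0 T) ∧
    ∃ Cu : ℝ, ∀ l : ℕ, l = 1 ∨ l = 2 → ∀ t ∈ Ioc 0 T,
      dgNorm m (iteratedDerivWithin l u (Ioc 0 T) t) ≤ Cu * (1 + t ^ (δ - (l : ℝ)))

end

end FeynmanKacLDG

end

/-! The error `e n = u (t n) - U n` is governed by a consistency estimate in time and a stability
estimate; the space discretization adds nothing, since both schemes share it. Throughout, μ = min(2
- α, γδ).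

Consistency. For a fixed point z, put f(s) = e^{κ(z)s} u(s)(z), so that |f''(s)| ≤ K s^{δ-2} with K
uniform in z (`exists_second_deriv_bound`). The L1 formula is the Caputo derivative of the piecewise
linear interpolant If, so the truncation error is a sum of integrals of (t_n - s)^{-α} (f - If)'. On
all intervals but the last, integration by parts moves the derivative onto the kernel, and f - If is
of size M^{-μ}(j+1)^{-α}: the grading makes the steps small where f'' is large. On the last interval
the kernel is integrable and (f - If)' is bounded directly. The result is a truncation error of size
t_n^{-α} M^{-μ} (`exists_truncation_bound`). The factor t_n^{-α} is harmless because the last L1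
coefficient A_{n-1}^n is at least t_n^{-α}/Γ(1-α).

Stability. Test the difference of the first equations with e and that of the second with the
difference q of the gradients. The weights of the two fluxes are complementary and the boundary is
periodic, so all edge terms cancel in the sum over the cells and -‖q‖² ≤ 0 remains
(`sum_cellInner_sub_le_zero`). The L1 coefficients are positive and decreasing, so the L1 derivative
of e times e dominates a discrete difference of squares (`l1Subst_mul_self_ge`). The factors
e^{-κ(t_n - t_{n-i})} may exceed 1; the weight e^{-b t_n} with b ≥ |κ| compensates for this. As e
vanishes at time 0, a surplus A_{n-1}^n/2 is left, which absorbs the truncation error by Young's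
inequality. Induction on n (`le_of_l1_inequality`) bounds the weighted error by M^{-μ}, and the
largest step is at least T/M. -/

noncomputable section

namespace FeynmanKacLDG

/-! ### Linear interpolation of functions of one variable -/

theorem abs_sub_le_sub_of_abs_deriv_le {f f' g g' : ℝ → ℝ} {a b : ℝ} (hab : a ≤ b)
    (hf : ContinuousOn f (Icc a b)) (hg : ContinuousOn g (Icc a b))
    (hf' : ∀ s ∈ Ioo a b, HasDerivAt f (f' s) s) (hg' : ∀ s ∈ Ioo a b, HasDerivAt g (g' s) s)
    (h : ∀ s ∈ Ioo a b, |f' s| ≤ g' s) : |f b - f a| ≤ g b - g a := by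
  have h1 : MonotoneOn (fun s => g s - f s) (Icc a b) := by
    refine monotoneOn_of_deriv_nonneg (convex_Icc a b) (hg.sub hf) ?_ ?_
    · rw [interior_Icc]
      exact fun s hs => ((hg' s hs).sub (hf' s hs)).differentiableAt.differentiableWithinAt
    · rw [interior_Icc]
      intro s hs
      have := ((hg' s hs).sub (hf' s hs)).deriv
      rw [show (fun s => g s - f s) = g - f from rfl, this]
      linarith [le_abs_self (f' s), h s hs]
  have h2 : MonotoneOn (fun s => g s + f s) (Icc a b) := by
    refine monotoneOn_of_deriv_nonneg (convex_Icc a b) (hg.add hf) ?_ ?_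
    · rw [interior_Icc]
      exact fun s hs => ((hg' s hs).add (hf' s hs)).differentiableAt.differentiableWithinAt
    · rw [interior_Icc]
      intro s hs
      have := ((hg' s hs).add (hf' s hs)).deriv
      rw [show (fun s => g s + f s) = g + f from rfl, this]
      linarith [neg_abs_le (f' s), h s hs]
  have e1 := h1 (left_mem_Icc.2 hab) (right_mem_Icc.2 hab) hab
  have e2 := h2 (left_mem_Icc.2 hab) (right_mem_Icc.2 hab) hab
  simp only at e1 e2
  rw [abs_le]
  constructor <;> linarith

theorem abs_deriv_sub_slope_le {f f1 f2 : ℝ → ℝ} {a b H : ℝ} (hab : a < b)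
    (hf : ContinuousOn f (Icc a b)) (h1 : ∀ s ∈ Ioo a b, HasDerivAt f (f1 s) s)
    (h2 : ∀ s ∈ Ioo a b, HasDerivAt f1 (f2 s) s) (hH : ∀ s ∈ Ioo a b, |f2 s| ≤ H)
    {s : ℝ} (hs : s ∈ Ioo a b) : |f1 s - (f b - f a) / (b - a)| ≤ H * (b - a) := by
  obtain ⟨ξ, hξ, hξ'⟩ := exists_hasDerivAt_eq_slope f f1 hab hf h1
  rw [← hξ']
  have := Convex.norm_image_sub_le_of_norm_hasDerivWithin_le (f := f1) (f' := f2) (s := Ioo a b)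
    (fun x hx => (h2 x hx).hasDerivWithinAt) (fun x hx => hH x hx) (convex_Ioo a b) hξ hs
  have hH0 : 0 ≤ H := (abs_nonneg _).trans (hH s hs)
  refine this.trans (mul_le_mul_of_nonneg_left ?_ hH0)
  rw [Real.norm_eq_abs, abs_le]
  constructor <;> linarith [hξ.1, hξ.2, hs.1, hs.2]

/-- The defect vanishes at a, and by the mean value theorem it equals (s - a) times the difference
between f' at some point and the chord slope. -/
theorem abs_sub_linear_le {f f1 f2 : ℝ → ℝ} {a b H : ℝ} (hab : a < b)
    (hf : ContinuousOn f (Icc a b)) (h1 : ∀ s ∈ Ioo a b, HasDerivAt f (f1 s) s)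
    (h2 : ∀ s ∈ Ioo a b, HasDerivAt f1 (f2 s) s) (hH : ∀ s ∈ Ioo a b, |f2 s| ≤ H)
    {s : ℝ} (hs : s ∈ Icc a b) :
    |f s - f a - (f b - f a) / (b - a) * (s - a)| ≤ H * (b - a) ^ 2 := by
  have hH0 : 0 ≤ H := (abs_nonneg _).trans (hH ((a + b) / 2) ⟨by linarith, by linarith⟩)
  rcases hs.1.eq_or_lt with rfl | has
  · simp only [sub_self, mul_zero, abs_zero]; positivity
  obtain ⟨η, hη, hη'⟩ := exists_hasDerivAt_eq_slope f f1 has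
    (hf.mono (Icc_subset_Icc_right hs.2)) fun x hx => h1 x ⟨hx.1, hx.2.trans_le hs.2⟩
  have hsa : 0 < s - a := by linarith
  have e : f s - f a = f1 η * (s - a) := by rw [hη']; field_simp
  rw [e, ← sub_mul, abs_mul, abs_of_pos hsa]
  have := abs_deriv_sub_slope_le hab hf h1 h2 hH (s := η) ⟨hη.1, hη.2.trans_le hs.2⟩
  have hb : 0 < b - a := by linarith
  calc _ ≤ H * (b - a) * (b - a) := by
        apply mul_le_mul this _ hsa.le (by positivity)
        linarith [hs.2]
    _ = _ := by ring

/-- The exponent δ - 1 may have either sign. Writing the power as s^δ / s avoids a case split: the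
numerator increases and the denominator is at least t/2. -/
theorem half_rpow_le {δ t s : ℝ} (hδ : δ ∈ Ioo (0 : ℝ) 2) (ht : 0 < t) (hs : t / 2 ≤ s)
    (hst : s ≤ t) : s ^ (δ - 1) ≤ 2 * t ^ (δ - 1) := by
  have hs0 : 0 < s := by linarith
  have h1 : s ^ δ ≤ t ^ δ := Real.rpow_le_rpow hs0.le hst hδ.1.le
  rw [Real.rpow_sub_one hs0.ne', Real.rpow_sub_one ht.ne']
  have : 0 ≤ t ^ δ := by positivity
  calc s ^ δ / s ≤ t ^ δ / (t / 2) := by gcongr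
    _ = _ := by field_simp

/-- Integrate K x^{δ-2}; the antiderivative K x^{δ-1}/(δ-1) needs δ ≠ 1. Bounding its increment by
the sum of both end values treats δ < 1 and δ > 1 alike. -/
theorem abs_deriv_sub_deriv_le_rpow {f1 f2 : ℝ → ℝ} {b K δ : ℝ}
    (hδ1 : δ ≠ 1) (hK : ∀ s ∈ Ioo 0 b, |f2 s| ≤ K * s ^ (δ - 2))
    (h2 : ∀ s ∈ Ioo 0 b, HasDerivAt f1 (f2 s) s) {s r : ℝ} (hs : s ∈ Ioo 0 b) (hr : r ∈ Ioo 0 b) :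
    |f1 s - f1 r| ≤ K / |δ - 1| * (s ^ (δ - 1) + r ^ (δ - 1)) := by
  wlog hrs : r ≤ s generalizing r s with H
  · rw [abs_sub_comm, add_comm]; exact H hr hs (le_of_not_ge hrs)
  have hδ' : δ - 1 ≠ 0 := sub_ne_zero.2 hδ1
  have hsub : Icc r s ⊆ Ioo 0 b := fun x hx => ⟨hr.1.trans_le hx.1, hx.2.trans_lt hs.2⟩
  have hK0 : 0 ≤ K := by
    by_contra hK0
    have := (abs_nonneg _).trans (hK s hs)
    have := Real.rpow_pos_of_pos hs.1 (δ - 2)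
    nlinarith
  have key := abs_sub_le_sub_of_abs_deriv_le (f := f1) (f' := f2)
    (g := fun x => K / (δ - 1) * x ^ (δ - 1)) (g' := fun x => K * x ^ (δ - 2)) hrs
    (fun x hx => (h2 x (hsub hx)).continuousAt.continuousWithinAt)
    (fun x hx => ((Real.continuousAt_rpow_const _ _
      (Or.inl (hsub hx).1.ne')).const_mul _).continuousWithinAt)
    (fun x hx => h2 x (hsub (Ioo_subset_Icc_self hx)))
    (fun x hx => by
      have := (Real.hasDerivAt_rpow_const (p := δ - 1)
        (Or.inl (hsub (Ioo_subset_Icc_self hx)).1.ne')).const_mul (K / (δ - 1))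
      convert! this using 1
      rw [show δ - 1 - 1 = δ - 2 by ring]; field_simp)
    (fun x hx => hK x (hsub (Ioo_subset_Icc_self hx)))
  refine key.trans ?_
  have hs' := Real.rpow_nonneg hs.1.le (δ - 1)
  have hr' := Real.rpow_nonneg hr.1.le (δ - 1)
  rw [← mul_sub]
  refine (le_abs_self _).trans ?_
  rw [abs_mul, abs_div, abs_of_nonneg hK0]
  gcongr
  rw [abs_le]; constructor <;> linarith

theorem hasDerivAt_sub_linear {f f1 : ℝ → ℝ} {s : ℝ} (h : HasDerivAt f (f1 s) s) (a c d : ℝ) :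
    HasDerivAt (fun s => f s - d - c * (s - a)) (f1 s - c) s := by
  have := (h.sub_const d).sub (((hasDerivAt_id s).sub_const a).const_mul c)
  simpa using! this

/-- Near 0 the derivative may blow up, and a mean value point could lie arbitrarily close to 0. The
reference line therefore has the slope of f at the midpoint, and the bound on f' - f'(b/2) is
integrated from 0. -/
theorem initial_interpolation_aux {f f1 f2 : ℝ → ℝ} {b K δ : ℝ} (hb : 0 < b)
    (hδ : δ ∈ Ioo (0 : ℝ) 2) (hδ1 : δ ≠ 1) (hK0 : 0 ≤ K) (hf : ContinuousOn f (Icc 0 b))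
    (h1 : ∀ s ∈ Ioo 0 b, HasDerivAt f (f1 s) s)
    (h2 : ∀ s ∈ Ioo 0 b, HasDerivAt f1 (f2 s) s)
    (hK : ∀ s ∈ Ioo 0 b, |f2 s| ≤ K * s ^ (δ - 2)) {s : ℝ} (hs : s ∈ Icc 0 b) :
    |f s - f 0 - f1 (b / 2) * s| ≤ K / |δ - 1| * (1 / δ + 2) * b ^ δ := by
  have hδ0 := hδ.1
  have hr : b / 2 ∈ Ioo 0 b := ⟨by linarith, by linarith⟩
  have hc : 0 ≤ K / |δ - 1| := by positivity
  have key := abs_sub_le_sub_of_abs_deriv_le (f := fun s => f s - f 0 - f1 (b / 2) * (s - 0))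
    (f' := fun s => f1 s - f1 (b / 2))
    (g := fun x => K / |δ - 1| * (1 / δ * x ^ δ + 2 * b ^ (δ - 1) * x))
    (g' := fun x => K / |δ - 1| * (x ^ (δ - 1) + 2 * b ^ (δ - 1))) hs.1
    (by
      have := hf.mono (Icc_subset_Icc_right hs.2)
      fun_prop)
    (by
      have : Continuous fun x : ℝ => x ^ δ := Real.continuous_rpow_const hδ0.le
      fun_prop)
    (fun x hx => hasDerivAt_sub_linear (h1 x ⟨hx.1, hx.2.trans_le hs.2⟩) 0 _ _)
    (fun x hx => by
      have := (((Real.hasDerivAt_rpow_const (p := δ) (Or.inl hx.1.ne')).const_mul (1 / δ)).add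
        ((hasDerivAt_id x).const_mul (2 * b ^ (δ - 1)))).const_mul (K / |δ - 1|)
      convert! this using 1
      field_simp)
    (fun x hx => by
      refine (abs_deriv_sub_deriv_le_rpow hδ1 hK h2 ⟨hx.1, hx.2.trans_le hs.2⟩ hr).trans ?_
      gcongr
      exact half_rpow_le hδ hb le_rfl (by linarith))
  simp only [sub_zero, mul_zero, sub_self, Real.zero_rpow hδ0.ne', add_zero] at key
  refine key.trans ?_
  rw [mul_assoc (K / |δ - 1|) (1 / δ + 2)]
  refine mul_le_mul_of_nonneg_left ?_ hc
  have e1 : s ^ δ ≤ b ^ δ := Real.rpow_le_rpow hs.1 hs.2 hδ0.le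
  have e2 : b ^ (δ - 1) * s ≤ b ^ δ := by
    rw [Real.rpow_sub_one hb.ne', div_mul_eq_mul_div, div_le_iff₀ hb]
    exact mul_le_mul_of_nonneg_left hs.2 (by positivity)
  have : 1 / δ * s ^ δ ≤ 1 / δ * b ^ δ := mul_le_mul_of_nonneg_left e1 (by positivity)
  nlinarith

theorem abs_deriv_sub_slope_le_initial {f f1 f2 : ℝ → ℝ} {b K δ : ℝ} (hb : 0 < b)
    (hδ : δ ∈ Ioo (0 : ℝ) 2) (hδ1 : δ ≠ 1) (hK0 : 0 ≤ K) (hf : ContinuousOn f (Icc 0 b))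
    (h1 : ∀ s ∈ Ioo 0 b, HasDerivAt f (f1 s) s)
    (h2 : ∀ s ∈ Ioo 0 b, HasDerivAt f1 (f2 s) s)
    (hK : ∀ s ∈ Ioo 0 b, |f2 s| ≤ K * s ^ (δ - 2)) {s : ℝ} (hs : s ∈ Ioo 0 b) :
    |f1 s - (f b - f 0) / b| ≤ K / |δ - 1| * (1 / δ + 4) * (s ^ (δ - 1) + b ^ (δ - 1)) := by
  have hδ0 := hδ.1
  have hr : b / 2 ∈ Ioo 0 b := ⟨by linarith, by linarith⟩
  have hc : 0 ≤ K / |δ - 1| := by positivity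
  have a1 := abs_deriv_sub_deriv_le_rpow hδ1 hK h2 hs hr
  have a2 := initial_interpolation_aux hb hδ hδ1 hK0 hf h1 h2 hK (right_mem_Icc.2 hb.le)
  have a3 : |(f b - f 0) / b - f1 (b / 2)| ≤ K / |δ - 1| * (1 / δ + 2) * b ^ (δ - 1) := by
    rw [Real.rpow_sub_one hb.ne', show (f b - f 0) / b - f1 (b / 2)
      = (f b - f 0 - f1 (b / 2) * b) / b by field_simp, abs_div, abs_of_pos hb, ← mul_div_assoc]
    gcongr
  have a4 := half_rpow_le hδ hb le_rfl (by linarith : b / 2 ≤ b)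
  calc |f1 s - (f b - f 0) / b|
      = |(f1 s - f1 (b / 2)) - ((f b - f 0) / b - f1 (b / 2))| := by congr 1; ring
    _ ≤ |f1 s - f1 (b / 2)| + |(f b - f 0) / b - f1 (b / 2)| := abs_sub _ _
    _ ≤ K / |δ - 1| * (s ^ (δ - 1) + 2 * b ^ (δ - 1))
        + K / |δ - 1| * (1 / δ + 2) * b ^ (δ - 1) := by
      refine add_le_add (a1.trans ?_) a3
      gcongr
    _ = K / |δ - 1| * (s ^ (δ - 1) + (1 / δ + 4) * b ^ (δ - 1)) := by ring
    _ ≤ K / |δ - 1| * ((1 / δ + 4) * s ^ (δ - 1) + (1 / δ + 4) * b ^ (δ - 1)) := by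
      have h0 : 0 ≤ s ^ (δ - 1) := Real.rpow_nonneg hs.1.le _
      have : 0 ≤ 1 / δ := by positivity
      gcongr
      nlinarith
    _ = _ := by ring

theorem abs_sub_linear_le_initial {f f1 f2 : ℝ → ℝ} {b K δ : ℝ} (hb : 0 < b)
    (hδ : δ ∈ Ioo (0 : ℝ) 2) (hδ1 : δ ≠ 1) (hK0 : 0 ≤ K) (hf : ContinuousOn f (Icc 0 b))
    (h1 : ∀ s ∈ Ioo 0 b, HasDerivAt f (f1 s) s)
    (h2 : ∀ s ∈ Ioo 0 b, HasDerivAt f1 (f2 s) s)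
    (hK : ∀ s ∈ Ioo 0 b, |f2 s| ≤ K * s ^ (δ - 2)) {s : ℝ} (hs : s ∈ Icc 0 b) :
    |f s - f 0 - (f b - f 0) / b * s| ≤ K / |δ - 1| * (2 / δ + 4) * b ^ δ := by
  have a1 := initial_interpolation_aux hb hδ hδ1 hK0 hf h1 h2 hK hs
  have a2 := initial_interpolation_aux hb hδ hδ1 hK0 hf h1 h2 hK (right_mem_Icc.2 hb.le)
  have e : f s - f 0 - (f b - f 0) / b * s
      = (f s - f 0 - f1 (b / 2) * s) - (f b - f 0 - f1 (b / 2) * b) * (s / b) := by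
    field_simp; ring
  have hsb : s / b ≤ 1 := (div_le_one hb).2 hs.2
  have hsb0 : 0 ≤ s / b := div_nonneg hs.1 hb.le
  rw [e]
  refine (abs_sub _ _).trans ?_
  rw [abs_mul, abs_of_nonneg hsb0]
  have := mul_le_of_le_one_right (abs_nonneg (f b - f 0 - f1 (b / 2) * b)) hsb
  calc _ ≤ K / |δ - 1| * (1 / δ + 2) * b ^ δ + K / |δ - 1| * (1 / δ + 2) * b ^ δ := by linarith
    _ = _ := by ring

/-! ### Integrals with a weakly singular kernel -/

theorem intervalIntegrable_kernel {α : ℝ} (hα : α < 1) (t a b : ℝ) :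
    IntervalIntegrable (fun s => (t - s) ^ (-α)) volume a b := by
  have := (intervalIntegral.intervalIntegrable_rpow' (r := -α) (by linarith)
    (a := t - a) (b := t - b)).comp_sub_left t
  simpa using this

theorem integral_kernel {α t a b : ℝ} (hα : α < 1) :
    ∫ s in a..b, (t - s) ^ (-α) = ((t - a) ^ (1 - α) - (t - b) ^ (1 - α)) / (1 - α) := by
  rw [intervalIntegral.integral_comp_sub_left (fun s : ℝ => s ^ (-α)) t,
    integral_rpow (Or.inl (by linarith))]
  rw [show -α + 1 = 1 - α by ring]

/-- Split at t/2: to the left the kernel is bounded, to the right the power is. Each summand of the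
majorant has at most one singular end point and integrates explicitly. -/
theorem kernel_mul_rpow_le {α δ t s : ℝ} (hα : α ∈ Ioo (0 : ℝ) 1) (hδ : δ ∈ Ioo (0 : ℝ) 2)
    (hs : s ∈ Ioo 0 t) : (t - s) ^ (-α) * s ^ (δ - 1)
      ≤ (t / 2) ^ (-α) * s ^ (δ - 1) + (t - s) ^ (-α) * (2 * t ^ (δ - 1)) := by
  have ht : 0 < t := hs.1.trans hs.2
  have h1 : 0 ≤ s ^ (δ - 1) := Real.rpow_nonneg hs.1.le _
  have h2 : 0 ≤ (t - s) ^ (-α) := Real.rpow_nonneg (by linarith [hs.2]) _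
  have h3 : 0 ≤ (t / 2) ^ (-α) := by positivity
  have h4 : 0 ≤ 2 * t ^ (δ - 1) := by positivity
  rcases le_total s (t / 2) with h | h
  · have : (t - s) ^ (-α) ≤ (t / 2) ^ (-α) :=
      Real.rpow_le_rpow_of_nonpos (by positivity) (by linarith) (by linarith [hα.1])
    have := mul_le_mul_of_nonneg_right this h1
    have := mul_nonneg h2 h4
    linarith
  · have := half_rpow_le hδ ht h hs.2.le
    have := mul_le_mul_of_nonneg_left this h2
    have := mul_nonneg h3 h1
    linarith

theorem intervalIntegrable_kernel_majorant {α δ t : ℝ} (hα : α ∈ Ioo (0 : ℝ) 1)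
    (hδ : δ ∈ Ioo (0 : ℝ) 2) : IntervalIntegrable
      (fun s => (t / 2) ^ (-α) * s ^ (δ - 1) + (t - s) ^ (-α) * (2 * t ^ (δ - 1))) volume 0 t :=
  ((intervalIntegral.intervalIntegrable_rpow' (by linarith [hδ.1])).const_mul _).add
    ((intervalIntegrable_kernel hα.2 t 0 t).mul_const _)

theorem intervalIntegrable_of_abs_le_of_continuousOn {f g : ℝ → ℝ} {a b : ℝ} (hab : a ≤ b)
    (hg : IntervalIntegrable g volume a b) (hf : ContinuousOn f (Ioo a b))
    (h : ∀ s ∈ Ioo a b, |f s| ≤ g s) : IntervalIntegrable f volume a b := by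
  rw [intervalIntegrable_iff_integrableOn_Ioo_of_le hab] at hg ⊢
  refine Integrable.mono' hg (hf.aestronglyMeasurable measurableSet_Ioo) ?_
  exact (ae_restrict_mem measurableSet_Ioo).mono fun s hs => h s hs

theorem abs_integral_le_of_abs_le {f g : ℝ → ℝ} {a b : ℝ} (hab : a ≤ b)
    (hg : IntervalIntegrable g volume a b) (h : ∀ s ∈ Ioo a b, |f s| ≤ g s) :
    |∫ s in a..b, f s| ≤ ∫ s in a..b, g s := by
  refine intervalIntegral.norm_integral_le_of_norm_le (f := f) hab ?_ hg
  filter_upwards [Measure.ae_ne volume b] with s hs hs'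
  exact h s ⟨hs'.1, lt_of_le_of_ne hs'.2 hs⟩

theorem continuousOn_kernel (α t a : ℝ) : ContinuousOn (fun s => (t - s) ^ (-α)) (Ioo a t) :=
  fun _ hs => ((continuousAt_const.sub continuousAt_id).rpow_const
    (Or.inl (sub_pos.2 hs.2).ne')).continuousWithinAt

theorem intervalIntegrable_deriv {f1 f2 : ℝ → ℝ} {t K δ : ℝ} (ht : 0 < t)
    (hδ : δ ∈ Ioo (0 : ℝ) 2) (hδ1 : δ ≠ 1)
    (h2 : ∀ s ∈ Ioo 0 t, HasDerivAt f1 (f2 s) s)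
    (hK : ∀ s ∈ Ioo 0 t, |f2 s| ≤ K * s ^ (δ - 2)) :
    IntervalIntegrable f1 volume 0 t := by
  have hr : t / 2 ∈ Ioo 0 t := ⟨by linarith, by linarith⟩
  have := intervalIntegrable_of_abs_le_of_continuousOn (f := fun s => f1 s - f1 (t / 2)) ht.le
    (((intervalIntegral.intervalIntegrable_rpow' (r := δ - 1) (by linarith [hδ.1])).add
      intervalIntegrable_const).const_mul (K / |δ - 1|))
    (fun s hs => ((h2 s hs).sub_const _).continuousAt.continuousWithinAt)
    (fun s hs => abs_deriv_sub_deriv_le_rpow hδ1 hK h2 hs hr)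
  simpa using this.add (intervalIntegrable_const (c := f1 (t / 2)))

theorem intervalIntegrable_kernel_mul_deriv {f1 f2 : ℝ → ℝ} {t K δ α : ℝ} (ht : 0 < t)
    (hα : α ∈ Ioo (0 : ℝ) 1) (hδ : δ ∈ Ioo (0 : ℝ) 2) (hδ1 : δ ≠ 1) (hK0 : 0 ≤ K)
    (h2 : ∀ s ∈ Ioo 0 t, HasDerivAt f1 (f2 s) s)
    (hK : ∀ s ∈ Ioo 0 t, |f2 s| ≤ K * s ^ (δ - 2)) :
    IntervalIntegrable (fun s => (t - s) ^ (-α) * f1 s) volume 0 t := by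
  have hr : t / 2 ∈ Ioo 0 t := ⟨by linarith, by linarith⟩
  have := intervalIntegrable_of_abs_le_of_continuousOn
    (f := fun s => (t - s) ^ (-α) * (f1 s - f1 (t / 2))) ht.le
    (((intervalIntegrable_kernel_majorant hα hδ).add
      ((intervalIntegrable_kernel hα.2 t 0 t).mul_const ((t / 2) ^ (δ - 1)))).const_mul
        (K / |δ - 1|))
    ((continuousOn_kernel α t 0).mul
      fun s hs => ((h2 s hs).sub_const _).continuousAt.continuousWithinAt)
    (fun s hs => by
      have h0 : 0 ≤ (t - s) ^ (-α) := Real.rpow_nonneg (by linarith [hs.2]) _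
      have a1 := abs_deriv_sub_deriv_le_rpow hδ1 hK h2 hs hr
      have a2 := kernel_mul_rpow_le hα hδ hs
      rw [abs_mul, abs_of_nonneg h0]
      calc _ ≤ (t - s) ^ (-α) * (K / |δ - 1| * (s ^ (δ - 1) + (t / 2) ^ (δ - 1))) := by gcongr
        _ = K / |δ - 1| * ((t - s) ^ (-α) * s ^ (δ - 1) + (t - s) ^ (-α) * (t / 2) ^ (δ - 1)) := by
          ring
        _ ≤ _ := by gcongr)
  have := this.add ((intervalIntegrable_kernel hα.2 t 0 t).mul_const (f1 (t / 2)))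
  refine this.congr fun s _ => ?_
  ring

/-- Integration by parts: g vanishes at both ends, so no boundary terms appear, and the derivative
of the kernel is nonnegative. The condition b < t keeps its non-integrable singularity away. -/
theorem abs_integral_kernel_mul_deriv_le_of_zero {g g1 : ℝ → ℝ} {a b t α G : ℝ} (hα : 0 < α)
    (hab : a ≤ b) (hbt : b < t) (hg : ContinuousOn g (Icc a b))
    (hg1 : ∀ s ∈ Ioo a b, HasDerivAt g (g1 s) s) (hi : IntervalIntegrable g1 volume a b)
    (ha : g a = 0) (hb : g b = 0) (hG : ∀ s ∈ Icc a b, |g s| ≤ G) :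
    |∫ s in a..b, (t - s) ^ (-α) * g1 s| ≤ G * ∫ s in a..b, α * (t - s) ^ (-α - 1) := by
  have hpos : ∀ s ∈ Icc a b, 0 < t - s := fun s hs => by linarith [hs.2]
  have hc : ∀ r : ℝ, ContinuousOn (fun s => (t - s) ^ r) (Icc a b) := fun r s hs =>
    ((continuousAt_const.sub continuousAt_id).rpow_const (Or.inl (hpos s hs).ne')).continuousWithinAt
  have hk1 : IntervalIntegrable (fun s => α * (t - s) ^ (-α - 1)) volume a b :=
    ((hc _).const_mul _ |>.mono (by rw [uIcc_of_le hab])).intervalIntegrable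
  have := intervalIntegral.integral_mul_deriv_eq_deriv_mul_of_hasDerivAt (a := a) (b := b)
    (u := fun s => (t - s) ^ (-α)) (u' := fun s => α * (t - s) ^ (-α - 1)) (v := g) (v' := g1)
    (by rw [uIcc_of_le hab]; exact hc _) (by rwa [uIcc_of_le hab])
    (by
      rw [min_eq_left hab, max_eq_right hab]
      intro s hs
      have := (((hasDerivAt_id s).const_sub t).rpow_const (p := -α)
        (Or.inl (hpos s (Ioo_subset_Icc_self hs)).ne'))
      convert! this using 1
      simp) (by rwa [min_eq_left hab, max_eq_right hab]) hk1 hi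
  rw [this, ha, hb, mul_zero, mul_zero, sub_zero, zero_sub, abs_neg,
    ← intervalIntegral.integral_const_mul]
  refine abs_integral_le_of_abs_le hab (hk1.const_mul G) fun s hs => ?_
  have h0 : 0 ≤ (t - s) ^ (-α - 1) := Real.rpow_nonneg (hpos s (Ioo_subset_Icc_self hs)).le _
  rw [abs_mul, abs_of_nonneg (by positivity), mul_comm]
  exact mul_le_mul_of_nonneg_right (hG s (Ioo_subset_Icc_self hs)) (by positivity)

theorem abs_integral_kernel_mul_le {g1 : ℝ → ℝ} {a t α H : ℝ} (hα : α < 1) (hat : a ≤ t)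
    (hH : ∀ s ∈ Ioo a t, |g1 s| ≤ H) :
    |∫ s in a..t, (t - s) ^ (-α) * g1 s| ≤ H * ((t - a) ^ (1 - α) / (1 - α)) := by
  have e := integral_kernel (a := a) (b := t) (t := t) hα
  rw [sub_self, Real.zero_rpow (by linarith), sub_zero] at e
  rw [← e, ← intervalIntegral.integral_const_mul]
  refine abs_integral_le_of_abs_le hat ((intervalIntegrable_kernel hα t a t).const_mul H)
    fun s hs => ?_
  have h0 : 0 ≤ (t - s) ^ (-α) := Real.rpow_nonneg (by linarith [hs.2]) _
  rw [abs_mul, abs_of_nonneg h0, mul_comm]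
  exact mul_le_mul_of_nonneg_right (hH s hs) h0

/-- This serves the first time step, where the kernel singularity and the initial singularity lie at
the two ends of the same interval. -/
theorem abs_integral_kernel_mul_le_initial {g1 : ℝ → ℝ} {t α δ K : ℝ} (ht : 0 < t)
    (hα : α ∈ Ioo (0 : ℝ) 1) (hδ : δ ∈ Ioo (0 : ℝ) 2) (hK0 : 0 ≤ K)
    (hg : ∀ s ∈ Ioo 0 t, |g1 s| ≤ K * (s ^ (δ - 1) + t ^ (δ - 1))) :
    |∫ s in 0..t, (t - s) ^ (-α) * g1 s| ≤ K * (2 / δ + 3 / (1 - α)) * t ^ (δ - α) := by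
  have hi := ((intervalIntegrable_kernel_majorant (t := t) hα hδ).add
      ((intervalIntegrable_kernel hα.2 t 0 t).mul_const (t ^ (δ - 1)))).const_mul K
  refine (abs_integral_le_of_abs_le ht.le hi fun s hs => ?_).trans ?_
  · have h0 : 0 ≤ (t - s) ^ (-α) := Real.rpow_nonneg (by linarith [hs.2]) _
    have a2 := kernel_mul_rpow_le hα hδ hs
    rw [abs_mul, abs_of_nonneg h0]
    calc _ ≤ (t - s) ^ (-α) * (K * (s ^ (δ - 1) + t ^ (δ - 1))) :=
          mul_le_mul_of_nonneg_left (hg s hs) h0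
      _ = K * ((t - s) ^ (-α) * s ^ (δ - 1) + (t - s) ^ (-α) * t ^ (δ - 1)) := by ring
      _ ≤ _ := by gcongr
  · have hδ0 := hδ.1
    have hα1 : 0 < 1 - α := sub_pos.2 hα.2
    have i1 : IntervalIntegrable (fun s => (t / 2) ^ (-α) * s ^ (δ - 1)) volume 0 t :=
      (intervalIntegral.intervalIntegrable_rpow' (by linarith [hδ.1])).const_mul _
    have i2 := intervalIntegrable_kernel hα.2 t 0 t
    rw [intervalIntegral.integral_const_mul,
      intervalIntegral.integral_add (i1.add (i2.mul_const _)) (i2.mul_const _),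
      intervalIntegral.integral_add i1 (i2.mul_const _), intervalIntegral.integral_const_mul,
      intervalIntegral.integral_mul_const, intervalIntegral.integral_mul_const,
      integral_kernel hα.2, integral_rpow (Or.inl (by linarith)), sub_self, sub_zero,
      show δ - 1 + 1 = δ by ring, Real.zero_rpow hδ0.ne', sub_zero,
      Real.zero_rpow hα1.ne', sub_zero, mul_assoc]
    refine mul_le_mul_of_nonneg_left ?_ hK0
    have e1 : (t / 2) ^ (-α) ≤ 2 * t ^ (-α) := by
      rw [Real.div_rpow ht.le (by norm_num), Real.rpow_neg (by norm_num : (0:ℝ) ≤ 2), div_inv_eq_mul,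
        mul_comm]
      refine mul_le_mul_of_nonneg_right ?_ (by positivity)
      calc (2 : ℝ) ^ α ≤ 2 ^ (1 : ℝ) := Real.rpow_le_rpow_of_exponent_le (by norm_num) hα.2.le
        _ = 2 := by norm_num
    have e2 : t ^ (-α) * t ^ δ = t ^ (δ - α) := by rw [← Real.rpow_add ht]; congr 1; ring
    have e3 : t ^ (1 - α) * t ^ (δ - 1) = t ^ (δ - α) := by
      rw [← Real.rpow_add ht]; congr 1; ring
    have : (t / 2) ^ (-α) * (t ^ δ / δ) ≤ 2 * t ^ (-α) * (t ^ δ / δ) :=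
      mul_le_mul_of_nonneg_right e1 (by positivity)
    calc _ ≤ 2 * t ^ (-α) * (t ^ δ / δ) + t ^ (1 - α) / (1 - α) * (2 * t ^ (δ - 1))
          + t ^ (1 - α) / (1 - α) * t ^ (δ - 1) := by linarith
      _ = 2 / δ * (t ^ (-α) * t ^ δ) + 3 / (1 - α) * (t ^ (1 - α) * t ^ (δ - 1)) := by ring
      _ = _ := by rw [e2, e3]; ring

/-! ### The graded mesh -/

theorem gradedTime_zero {T γ : ℝ} (hγ : 1 ≤ γ) (M : ℕ) : gradedTime T γ M 0 = 0 := by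
  simp [gradedTime, Real.zero_rpow (by linarith : γ ≠ 0)]

theorem gradedTime_self {T γ : ℝ} {M : ℕ} (hM : 1 ≤ M) : gradedTime T γ M M = T := by
  have : (M : ℝ) ≠ 0 := by positivity
  simp [gradedTime, div_self this]

theorem gradedTime_strictMono {T γ : ℝ} (hT : 0 < T) (hγ : 1 ≤ γ) {M : ℕ} (hM : 1 ≤ M) :
    StrictMono (gradedTime T γ M) := by
  intro a b hab
  have : (0 : ℝ) < M := by positivity
  unfold gradedTime
  gcongr

theorem gradedTime_pos {T γ : ℝ} (hT : 0 < T) {M : ℕ} (hM : 1 ≤ M) {n : ℕ} (hn : 1 ≤ n) :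
    0 < gradedTime T γ M n := by
  have : (0 : ℝ) < M := by positivity
  have : (0 : ℝ) < n := by positivity
  unfold gradedTime
  positivity

theorem gradedTime_le {T γ : ℝ} (hT : 0 < T) (hγ : 1 ≤ γ) {M : ℕ} (hM : 1 ≤ M) {n : ℕ}
    (hn : n ≤ M) : gradedTime T γ M n ≤ T :=
  ((gradedTime_strictMono hT hγ hM).monotone hn).trans_eq (gradedTime_self hM)

theorem gradedTime_eq_mul {T γ : ℝ} {M : ℕ} (j : ℕ) {n : ℕ} (hn : 1 ≤ n) :
    gradedTime T γ M j = ((j : ℝ) / n) ^ γ * gradedTime T γ M n := by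
  have : (n : ℝ) ≠ 0 := by positivity
  unfold gradedTime
  rw [← mul_assoc, ← Real.mul_rpow (by positivity) (by positivity), div_mul_div_cancel₀ this]

theorem gradedTime_le_mul {T γ : ℝ} (hT : 0 < T) (hγ : 1 ≤ γ) {M : ℕ} (hM : 1 ≤ M) {j n : ℕ}
    (hn : 1 ≤ n) (hjn : j ≤ n) : gradedTime T γ M j ≤ (j : ℝ) / n * gradedTime T γ M n := by
  rw [gradedTime_eq_mul j hn]
  have h1 : (j : ℝ) / n ≤ 1 := div_le_one_of_le₀ (by exact_mod_cast hjn) (by positivity)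
  refine mul_le_mul_of_nonneg_right ?_ (gradedTime_pos hT hM hn).le
  calc ((j : ℝ) / n) ^ γ ≤ ((j : ℝ) / n) ^ (1 : ℝ) :=
        Real.rpow_le_rpow_of_exponent_ge_of_imp (by positivity) h1 hγ
          (fun _ h => by linarith)
    _ = _ := Real.rpow_one _

/-- Bernoulli's inequality for (1 - 1/(n+1))^γ. -/
theorem gradedTime_step_le {T γ : ℝ} (hT : 0 < T) (hγ : 1 ≤ γ) {M : ℕ} (hM : 1 ≤ M) (n : ℕ) :
    gradedTime T γ M (n + 1) - gradedTime T γ M n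
      ≤ γ * gradedTime T γ M (n + 1) / (n + 1) := by
  have h0 := gradedTime_pos (γ := γ) hT hM (Nat.le_add_left 1 n)
  have hn : (0 : ℝ) < n + 1 := by positivity
  have key := one_add_mul_self_le_rpow_one_add (s := -1 / ((n : ℝ) + 1))
    (by rw [le_div_iff₀ hn]; linarith [(Nat.cast_nonneg n : (0 : ℝ) ≤ n)]) hγ
  have e : (1 : ℝ) + -1 / ((n : ℝ) + 1) = (n : ℝ) / ((n + 1 : ℕ) : ℝ) := by
    push_cast; field_simp; ring
  rw [e] at key
  rw [gradedTime_eq_mul n (Nat.le_add_left 1 n)]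
  have := mul_le_mul_of_nonneg_right key h0.le
  have e2 : γ * gradedTime T γ M (n + 1) / (n + 1)
    = gradedTime T γ M (n + 1) - (1 + γ * (-1 / ((n : ℝ) + 1))) * gradedTime T γ M (n + 1) := by
    field_simp; ring
  rw [e2]
  linarith

theorem gradedTime_succ_le {T γ : ℝ} (hT : 0 < T) (hγ : 1 ≤ γ) {M : ℕ} (hM : 1 ≤ M) {n : ℕ}
    (hn : 1 ≤ n) : gradedTime T γ M (n + 1) ≤ 2 ^ γ * gradedTime T γ M n := by
  have h1 : (1 : ℝ) ≤ n := by exact_mod_cast hn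
  rw [gradedTime_eq_mul (n + 1) hn]
  have h0 := gradedTime_pos (γ := γ) hT hM hn
  gcongr
  rw [div_le_iff₀ (by linarith)]
  push_cast
  linarith

/-- Here the rate μ = min(2 - α, γδ) arises. As x/M ≤ 1, the exponent γδ may be lowered to μ; as x ≥
1 and μ ≤ 2 - α, the remaining power of x is at most 1. -/
theorem gradedTime_rpow_mul_le {T γ δ α : ℝ} (hT : 0 < T)
    {M x : ℕ} (hM : 1 ≤ M) (hx : 1 ≤ x) (hxM : x ≤ M) :
    gradedTime T γ M x ^ δ * (x : ℝ) ^ (-(2 - α))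
      ≤ T ^ δ * (M : ℝ) ^ (-min (2 - α) (γ * δ)) := by
  set μ := min (2 - α) (γ * δ)
  have hM' : (0 : ℝ) < M := by positivity
  have hx' : (1 : ℝ) ≤ x := by exact_mod_cast hx
  have hx0 : (0 : ℝ) < x := by linarith
  have h1 : (x : ℝ) / M ≤ 1 := div_le_one_of_le₀ (by exact_mod_cast hxM) hM'.le
  have e1 : gradedTime T γ M x ^ δ = T ^ δ * ((x : ℝ) / M) ^ (γ * δ) := by
    unfold gradedTime
    rw [Real.mul_rpow (by positivity) hT.le, ← Real.rpow_mul (by positivity), mul_comm]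
  have e2 : ((x : ℝ) / M) ^ (γ * δ) ≤ ((x : ℝ) / M) ^ μ :=
    Real.rpow_le_rpow_of_exponent_ge (by positivity) h1 (min_le_right _ _)
  have e3 : (x : ℝ) ^ μ * (x : ℝ) ^ (-(2 - α)) ≤ 1 := by
    rw [← Real.rpow_add hx0]
    exact Real.rpow_le_one_of_one_le_of_nonpos hx' (by linarith [min_le_left (2 - α) (γ * δ)])
  rw [e1, mul_assoc]
  refine mul_le_mul_of_nonneg_left ?_ (by positivity)
  calc _ ≤ ((x : ℝ) / M) ^ μ * (x : ℝ) ^ (-(2 - α)) := by gcongr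
    _ = (M : ℝ) ^ (-μ) * ((x : ℝ) ^ μ * (x : ℝ) ^ (-(2 - α))) := by
      rw [Real.div_rpow hx0.le hM'.le, Real.rpow_neg hM'.le]; field_simp
    _ ≤ _ := mul_le_of_le_one_right (by positivity) e3

/-- The M steps add up to T, so the largest is at least their mean. -/
theorem div_le_maxStep {T γ : ℝ} (hγ : 1 ≤ γ) {M : ℕ} (hM : 1 ≤ M) :
    T / M ≤ maxStep T γ M := by
  have hM' : (0 : ℝ) < M := by positivity
  rw [div_le_iff₀ hM']
  have h1 : ∑ i : Fin M, (gradedTime T γ M ((i : ℕ) + 1) - gradedTime T γ M (i : ℕ)) = T := by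
    rw [Fin.sum_univ_eq_sum_range
      (fun i => gradedTime T γ M (i + 1) - gradedTime T γ M i) M, Finset.sum_range_sub,
      gradedTime_self hM, gradedTime_zero hγ, sub_zero]
  calc T = _ := h1.symm
    _ ≤ ∑ i : Fin M, maxStep T γ M :=
      Finset.sum_le_sum fun i _ => le_ciSup (f := fun i : Fin M =>
        gradedTime T γ M ((i : ℕ) + 1) - gradedTime T γ M (i : ℕ)) (Set.finite_range _).bddAbove i
    _ = _ := by simp [mul_comm]

/-! ### The L1 formula -/

/-- The L1 approximation of the Caputo derivative as a weighted sum of increments. -/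
def l1Diff (α : ℝ) (t : ℕ → ℝ) (n : ℕ) (F : ℕ → ℝ) : ℝ :=
  ∑ j ∈ Finset.range n, l1Coeff α t n (n - 1 - j) * (F (j + 1) - F j)

/-- Summation by parts. It passes between the two forms of the L1 formula and, with F = 1, sums the
differences of the coefficients. -/
theorem sum_increments_eq (A F : ℕ → ℝ) {n : ℕ} (hn : 1 ≤ n) :
    ∑ j ∈ Finset.range n, A (n - 1 - j) * (F (j + 1) - F j)
      = A 0 * F n - A (n - 1) * F 0 + ∑ i ∈ Finset.Ico 1 n, (A i - A (i - 1)) * F (n - i) := by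
  obtain ⟨N, rfl⟩ : ∃ N, n = N + 1 := ⟨n - 1, by omega⟩
  rw [← Finset.sum_range_reflect, Finset.sum_Ico_eq_sum_range]
  have e : ∀ j ∈ Finset.range (N + 1),
      A (N + 1 - 1 - (N + 1 - 1 - j)) * (F (N + 1 - 1 - j + 1) - F (N + 1 - 1 - j))
        = A j * F (N + 1 - j) - A j * F (N - j) := by
    intro j hj
    have hj' : j ≤ N := Nat.lt_succ_iff.1 (Finset.mem_range.1 hj)
    rw [show N + 1 - 1 - (N + 1 - 1 - j) = j by omega, show N + 1 - 1 - j + 1 = N + 1 - j by omega,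
      show N + 1 - 1 - j = N - j by omega, mul_sub]
  rw [Finset.sum_congr rfl e, Finset.sum_sub_distrib, Finset.sum_range_succ',
    Finset.sum_range_succ (fun j => A j * F (N - j))]
  have e' : ∀ j ∈ Finset.range (N + 1 - 1), (A (1 + j) - A (1 + j - 1)) * F (N + 1 - (1 + j))
      = A (j + 1) * F (N + 1 - (j + 1)) - A j * F (N - j) := by
    intro j _
    rw [show 1 + j - 1 = j by omega, show N + 1 - (1 + j) = N - j by omega,
      show N + 1 - (j + 1) = N - j by omega, add_comm 1 j, sub_mul]
  rw [Finset.sum_congr rfl e', Finset.sum_sub_distrib]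
  simp only [Nat.add_sub_cancel, Nat.sub_self, Nat.sub_zero]
  ring

/-- Conjugation by e^{κt} reduces the substantial formula to the plain one, so that truncation can
be studied for e^{κs}f(s). The weight of f 0 has the required form because t 0 = 0. -/
theorem l1Subst_eq {t : ℕ → ℝ} (α κ : ℝ) {n : ℕ} (ht : t 0 = 0) (hn : 1 ≤ n) (f : ℕ → ℝ) :
    l1Subst α κ t n f
      = Real.exp (-κ * t n) * l1Diff α t n (fun j => Real.exp (κ * t j) * f j) := by
  have hexp : ∀ i, Real.exp (-κ * (t n - t (n - i)))
      = Real.exp (-κ * t n) * Real.exp (κ * t (n - i)) := by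
    intro i; rw [← Real.exp_add]; congr 1; ring
  have h1 : Real.exp (-κ * t n) * Real.exp (κ * t n) = 1 := by
    rw [← Real.exp_add]; simp
  unfold l1Diff l1Subst
  rw [sum_increments_eq (fun i => l1Coeff α t n i) (fun j => Real.exp (κ * t j) * f j) hn,
    mul_add, Finset.mul_sum]
  congr 1
  · rw [ht, mul_zero, Real.exp_zero, mul_sub]
    linear_combination (-(l1Coeff α t n 0 * f n)) * h1
  · refine Finset.sum_congr rfl fun i _ => ?_
    rw [hexp]; ring

/-- Since Γ(2-α) = (1-α)Γ(1-α), the coefficient is a mean value of the kernel; this identifies the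
L1 formula with the Caputo derivative of the interpolant. -/
theorem l1Coeff_eq_integral {α : ℝ} (hα : α ∈ Ioo (0 : ℝ) 1) (t : ℕ → ℝ) {n j : ℕ}
    (hj : j < n) : l1Coeff α t n (n - 1 - j) = 1 / Real.Gamma (1 - α)
      * ((∫ s in (t j)..(t (j + 1)), (t n - s) ^ (-α)) / (t (j + 1) - t j)) := by
  unfold l1Coeff
  have hα1 : 1 - α ≠ 0 := (sub_pos.2 hα.2).ne'
  rw [show n - (n - 1 - j) - 1 = j by omega, show n - (n - 1 - j) = j + 1 by omega,
    integral_kernel hα.2, show 2 - α = (1 - α) + 1 by ring, Real.Gamma_add_one hα1]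
  simp only [div_eq_mul_inv, mul_inv]
  ring

/-- The L1 coefficients decrease. -/
theorem l1Coeff_le {α : ℝ} (hα : α ∈ Ioo (0 : ℝ) 1) {t : ℕ → ℝ} (ht : StrictMono t) {n i : ℕ}
    (hi : 1 ≤ i) (hin : i < n) : l1Coeff α t n i ≤ l1Coeff α t n (i - 1) := by
  unfold l1Coeff
  rw [show n - (i - 1) - 1 = n - i by omega]
  have a1 : t (n - i - 1) < t (n - i) := ht (by omega)
  have a2 : t (n - i) < t (n - (i - 1)) := ht (by omega)
  have a3 : t (n - (i - 1)) ≤ t n := ht.monotone (by omega)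
  have hG : 0 < Real.Gamma (2 - α) := Real.Gamma_pos_of_pos (by linarith [hα.2])
  -- Up to Γ(2-α), consecutive coefficients are slopes of the concave function x^{1-α} over adjacent
  -- intervals.
  have := (Real.concaveOn_rpow (p := 1 - α) (by linarith [hα.2]) (by linarith [hα.1])).slope_anti_adjacent
    (x := t n - t (n - (i - 1))) (y := t n - t (n - i)) (z := t n - t (n - i - 1))
    (mem_Ici.2 (by linarith)) (mem_Ici.2 (by linarith)) (by linarith) (by linarith)
  rw [mul_comm, ← div_div, mul_comm, ← div_div]
  refine div_le_div_of_nonneg_right ?_ hG.le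
  convert! this using 2 <;> ring

/-- Lower bound for the last L1 coefficient. -/
theorem rpow_div_Gamma_le_l1Coeff {α : ℝ} (hα : α ∈ Ioo (0 : ℝ) 1) {t : ℕ → ℝ}
    (ht : StrictMono t) (ht0 : t 0 = 0) {n : ℕ} (hn : 1 ≤ n) :
    t n ^ (-α) / Real.Gamma (1 - α) ≤ l1Coeff α t n (n - 1) := by
  have e := l1Coeff_eq_integral hα t (n := n) (j := 0) (by omega)
  rw [Nat.sub_zero, zero_add, ht0, sub_zero] at e
  rw [e, div_eq_inv_mul, ← one_div]
  have h1 : 0 < t 1 := ht0 ▸ ht one_pos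
  have h1n : t 1 ≤ t n := ht.monotone hn
  have hG : 0 < Real.Gamma (1 - α) := Real.Gamma_pos_of_pos (by linarith [hα.2])
  refine mul_le_mul_of_nonneg_left ?_ (by positivity)
  rw [le_div_iff₀ h1]
  calc t n ^ (-α) * t 1 = ∫ s in (0 : ℝ)..t 1, t n ^ (-α) := by simp [mul_comm]
    _ ≤ _ := by
      refine intervalIntegral.integral_mono_on_of_le_Ioo h1.le intervalIntegrable_const
        (intervalIntegrable_kernel hα.2 _ _ _) fun s hs => ?_
      exact Real.rpow_le_rpow_of_nonpos (by linarith [hs.2]) (by linarith [hs.1])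
        (by linarith [hα.1])

/-! ### The truncation error of the L1 formula on graded meshes -/

theorem caputo_sub_l1Diff_eq {f f1 f2 : ℝ → ℝ} {α δ K : ℝ} {t : ℕ → ℝ} {n : ℕ} (hn : 1 ≤ n)
    (hα : α ∈ Ioo (0 : ℝ) 1) (hδ : δ ∈ Ioo (0 : ℝ) 2) (hδ1 : δ ≠ 1) (hK0 : 0 ≤ K)
    (ht : StrictMono t) (ht0 : t 0 = 0)
    (h1 : ∀ s ∈ Ioo 0 (t n), HasDerivAt f (f1 s) s)
    (h2 : ∀ s ∈ Ioo 0 (t n), HasDerivAt f1 (f2 s) s)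
    (hK : ∀ s ∈ Ioo 0 (t n), |f2 s| ≤ K * s ^ (δ - 2)) :
    caputo α f (t n) - l1Diff α t n (fun j => f (t j))
      = 1 / Real.Gamma (1 - α) * ∑ j ∈ Finset.range n, ∫ s in (t j)..(t (j + 1)),
        (t n - s) ^ (-α) * (f1 s - (f (t (j + 1)) - f (t j)) / (t (j + 1) - t j)) := by
  have htn : 0 < t n := ht0 ▸ ht (by omega)
  have hi := intervalIntegrable_kernel_mul_deriv htn hα hδ hδ1 hK0 h2 hK
  have hij : ∀ j < n, IntervalIntegrable (fun s => (t n - s) ^ (-α) * f1 s) volume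
      (t j) (t (j + 1)) := fun j hj => by
    refine hi.mono_set ?_
    have h3 : t j < t (j + 1) := ht (by omega)
    rw [uIcc_of_le h3.le, uIcc_of_le htn.le]
    exact Icc_subset_Icc (ht0 ▸ ht.monotone (by omega)) (ht.monotone (by omega))
  have e1 : ∫ s in (0 : ℝ)..t n, (t n - s) ^ (-α) * deriv f s
      = ∑ j ∈ Finset.range n, ∫ s in (t j)..(t (j + 1)), (t n - s) ^ (-α) * f1 s := by
    rw [intervalIntegral.sum_integral_adjacent_intervals hij, ht0]
    refine intervalIntegral.integral_congr_Ioo_of_le htn.le fun s hs => ?_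
    simp only [(h1 s hs).deriv]
  unfold caputo l1Diff
  rw [e1, Finset.mul_sum, Finset.mul_sum, ← Finset.sum_sub_distrib]
  refine Finset.sum_congr rfl fun j hj => ?_
  rw [l1Coeff_eq_integral hα t (Finset.mem_range.1 hj), mul_assoc, ← mul_sub]
  congr 1
  simp_rw [mul_sub]
  rw [intervalIntegral.integral_sub (hij j (Finset.mem_range.1 hj))
    ((intervalIntegrable_kernel hα.2 _ _ _).mul_const _), intervalIntegral.integral_mul_const]
  ring

/-- If 2(j+1) ≤ n, the grading puts t_{j+1} below t_n/2, and the kernel is not singular. Otherwise j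
+ 1 is comparable with n, and the power supplies n^{-α}. -/
theorem rpow_mul_kernel_le {T γ α s : ℝ} (hT : 0 < T) (hγ : 1 ≤ γ) (hα : α ∈ Ioo (0 : ℝ) 1)
    {M n j : ℕ} (hM : 1 ≤ M) (hjn : j + 1 < n) (hs : s ≤ gradedTime T γ M (j + 1)) :
    ((j : ℝ) + 1) ^ (-α) * (gradedTime T γ M n - s) ^ (-α - 1)
      ≤ (gradedTime T γ M n / 2) ^ (-α - 1)
        + 2 ^ α * (n : ℝ) ^ (-α) * (gradedTime T γ M n - s) ^ (-α - 1) := by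
  set t := gradedTime T γ M
  have hj : t (j + 1) < t n := gradedTime_strictMono hT hγ hM hjn
  have htn : 0 < t n := gradedTime_pos hT hM (by omega)
  have hn : (0 : ℝ) < n := by exact_mod_cast (by omega : 0 < n)
  have h0 : 0 ≤ (t n - s) ^ (-α - 1) := Real.rpow_nonneg (by linarith) _
  have h00 : 0 ≤ (t n / 2) ^ (-α - 1) := by positivity
  have h01 : 0 ≤ 2 ^ α * (n : ℝ) ^ (-α) := by positivity
  rcases le_or_gt (2 * (j + 1)) n with h | h
  · have a1 : t (j + 1) ≤ t n / 2 := by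
      refine (gradedTime_le_mul hT hγ hM (by omega) hjn.le).trans ?_
      have : ((j + 1 : ℕ) : ℝ) / n ≤ 1 / 2 := by
        rw [div_le_div_iff₀ hn two_pos]
        have : ((2 * (j + 1) : ℕ) : ℝ) ≤ n := by exact_mod_cast h
        push_cast at this ⊢; linarith
      nlinarith
    have a2 : ((j : ℝ) + 1) ^ (-α) ≤ 1 :=
      Real.rpow_le_one_of_one_le_of_nonpos (by linarith [(Nat.cast_nonneg j : (0 : ℝ) ≤ j)])
        (by linarith [hα.1])
    have a3 : (t n - s) ^ (-α - 1) ≤ (t n / 2) ^ (-α - 1) :=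
      Real.rpow_le_rpow_of_nonpos (by positivity) (by linarith) (by linarith [hα.1])
    have := mul_nonneg h01 h0
    have := mul_le_of_le_one_left h0 a2
    linarith
  · have a2 : ((j : ℝ) + 1) ^ (-α) ≤ 2 ^ α * (n : ℝ) ^ (-α) := by
      have : ((n : ℝ) / 2) ^ (-α) = 2 ^ α * (n : ℝ) ^ (-α) := by
        rw [Real.div_rpow hn.le two_pos.le, Real.rpow_neg two_pos.le, div_inv_eq_mul, mul_comm]
      rw [← this]
      refine Real.rpow_le_rpow_of_nonpos (by positivity) ?_ (by linarith [hα.1])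
      have : (n : ℝ) < ((2 * (j + 1) : ℕ) : ℝ) := by exact_mod_cast h
      push_cast at this; linarith
    have := mul_le_mul_of_nonneg_right a2 h0
    linarith

theorem integral_kernel_deriv {α t a b : ℝ} (hα : 0 < α) (hab : a ≤ b) (hbt : b < t) :
    ∫ s in a..b, α * (t - s) ^ (-α - 1) = (t - b) ^ (-α) - (t - a) ^ (-α) := by
  rw [intervalIntegral.integral_const_mul,
    intervalIntegral.integral_comp_sub_left (fun s : ℝ => s ^ (-α - 1)) t,
    integral_rpow (Or.inr ⟨by linarith, ?_⟩)]
  · rw [show -α - 1 + 1 = -α by ring]; field_simp; ring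
  · rw [uIcc_of_le (by linarith)]
    intro h; linarith [h.1]

/-- The decay (j+1)^{-α} of the interpolation error pays for the strongly singular kernel. In the
constant 6, the part of the kernel away from t_n contributes 4 and the part near t_n contributes 2.
-/
theorem sum_rpow_mul_integral_kernel_deriv_le {T γ α : ℝ} (hT : 0 < T) (hγ : 1 ≤ γ)
    (hα : α ∈ Ioo (0 : ℝ) 1) {M : ℕ} (N : ℕ) (hM : 1 ≤ M) :
    ∑ j ∈ Finset.range N, ((j : ℝ) + 1) ^ (-α)
      * ∫ s in (gradedTime T γ M j)..(gradedTime T γ M (j + 1)),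
          α * (gradedTime T γ M (N + 1) - s) ^ (-α - 1)
      ≤ 6 * gradedTime T γ M (N + 1) ^ (-α) := by
  set t := gradedTime T γ M with ht
  have hmono : StrictMono t := gradedTime_strictMono hT hγ hM
  have ht0 : t 0 = 0 := gradedTime_zero hγ M
  have htn : 0 < t (N + 1) := gradedTime_pos hT hM (by omega)
  have hα0 := hα.1
  have hNn : (0 : ℝ) < ((N + 1 : ℕ) : ℝ) := by positivity
  have hint : ∀ j < N, ∀ r : ℝ, IntervalIntegrable (fun s => (t (N + 1) - s) ^ r) volume
      (t j) (t (j + 1)) := fun j hj r => by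
    refine ContinuousOn.intervalIntegrable fun s hs => ?_
    have h3 : t j < t (j + 1) := hmono (by omega)
    have h4 : t (j + 1) < t (N + 1) := hmono (by omega)
    rw [uIcc_of_le h3.le] at hs
    exact ((continuousAt_const.sub continuousAt_id).rpow_const
      (Or.inl (sub_ne_zero.2 (hs.2.trans_lt h4).ne'))).continuousWithinAt
  have a1 : ∀ j ∈ Finset.range N, ((j : ℝ) + 1) ^ (-α) * ∫ s in (t j)..(t (j + 1)),
      α * (t (N + 1) - s) ^ (-α - 1) ≤ α * (t (N + 1) / 2) ^ (-α - 1) * (t (j + 1) - t j)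
        + 2 ^ α * ((N + 1 : ℕ) : ℝ) ^ (-α)
          * ((t (N + 1) - t (j + 1)) ^ (-α) - (t (N + 1) - t j) ^ (-α)) := by
    intro j hj
    have hj' := Finset.mem_range.1 hj
    have h3 : t j < t (j + 1) := hmono (by omega)
    have h4 : t (j + 1) < t (N + 1) := hmono (by omega)
    have i1 := hint j hj' (-α - 1)
    rw [← integral_kernel_deriv hα0 h3.le h4, ← intervalIntegral.integral_const_mul,
      ← intervalIntegral.integral_const_mul]
    calc _ ≤ ∫ s in (t j)..(t (j + 1)), (α * (t (N + 1) / 2) ^ (-α - 1)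
            + 2 ^ α * ((N + 1 : ℕ) : ℝ) ^ (-α) * (α * (t (N + 1) - s) ^ (-α - 1))) := by
          refine intervalIntegral.integral_mono_on h3.le ((i1.const_mul _).const_mul _)
            (intervalIntegrable_const.add ((i1.const_mul _).const_mul _)) fun s hs => ?_
          have := rpow_mul_kernel_le hT hγ hα hM (n := N + 1) (by omega) hs.2
          have := mul_le_mul_of_nonneg_left this hα0.le
          calc _ = α * (((j : ℝ) + 1) ^ (-α) * (t (N + 1) - s) ^ (-α - 1)) := by ring
            _ ≤ _ := this
            _ = _ := by ring
      _ = _ := by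
        rw [intervalIntegral.integral_add intervalIntegrable_const ((i1.const_mul _).const_mul _),
          intervalIntegral.integral_const, smul_eq_mul, mul_comm (t (j + 1) - t j)]
  refine (Finset.sum_le_sum a1).trans ?_
  rw [Finset.sum_add_distrib, ← Finset.mul_sum, ← Finset.mul_sum, Finset.sum_range_sub,
    Finset.sum_range_sub (fun j => (t (N + 1) - t j) ^ (-α)), ht0, sub_zero, sub_zero]
  have hN : t N < t (N + 1) := hmono (by omega)
  -- The telescoped sum leaves the kernel at t_N. The last step is at least t_{N+1}/(N+1), and the
  -- factor (N+1)^{-α} then cancels exactly.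
  have b1 : (t (N + 1) - t N) ^ (-α) ≤ (t (N + 1) / ((N + 1 : ℕ) : ℝ)) ^ (-α) := by
    refine Real.rpow_le_rpow_of_nonpos (by positivity) ?_ (by linarith)
    have := gradedTime_le_mul hT hγ hM (j := N) (n := N + 1) (by omega) (by omega)
    have e : (N : ℝ) / ((N + 1 : ℕ) : ℝ) * t (N + 1)
        = t (N + 1) - t (N + 1) / ((N + 1 : ℕ) : ℝ) := by
      push_cast; field_simp; ring
    rw [← ht] at this
    linarith
  have b2 : ((N + 1 : ℕ) : ℝ) ^ (-α) * (t (N + 1) / ((N + 1 : ℕ) : ℝ)) ^ (-α)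
      = t (N + 1) ^ (-α) := by
    rw [← Real.mul_rpow hNn.le (by positivity), mul_div_cancel₀ _ hNn.ne']
  have b3 : (2 : ℝ) ^ α ≤ 2 := by
    calc (2 : ℝ) ^ α ≤ 2 ^ (1 : ℝ) := Real.rpow_le_rpow_of_exponent_le (by norm_num) hα.2.le
      _ = 2 := by norm_num
  have b4 : (t (N + 1) / 2) ^ (-α - 1) * t N ≤ 4 * t (N + 1) ^ (-α) := by
    have e : (t (N + 1) / 2) ^ (-α - 1) = 2 * 2 ^ α * (t (N + 1) ^ (-α) / t (N + 1)) := by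
      rw [Real.rpow_sub_one (by positivity), Real.div_rpow htn.le two_pos.le,
        Real.rpow_neg two_pos.le]
      field_simp
    rw [e, mul_assoc, div_mul_eq_mul_div]
    have c1 : t (N + 1) ^ (-α) * t N / t (N + 1) ≤ t (N + 1) ^ (-α) := by
      rw [div_le_iff₀ htn]; gcongr
    have c2 : 0 ≤ t (N + 1) ^ (-α) := by positivity
    have c3 : 0 ≤ (2 : ℝ) ^ α := by positivity
    nlinarith
  have c0 : 0 ≤ t (N + 1) ^ (-α) := by positivity
  have b5 : α * (t (N + 1) / 2) ^ (-α - 1) * t N ≤ 4 * t (N + 1) ^ (-α) := by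
    have hnn : 0 ≤ (t (N + 1) / 2) ^ (-α - 1) * t N :=
      mul_nonneg (by positivity) (ht0 ▸ hmono.monotone (Nat.zero_le N))
    rw [mul_assoc]
    exact (mul_le_of_le_one_left hnn hα.2.le).trans b4
  have b6 : 2 ^ α * ((N + 1 : ℕ) : ℝ) ^ (-α) * ((t (N + 1) - t N) ^ (-α) - t (N + 1) ^ (-α))
      ≤ 2 * t (N + 1) ^ (-α) := by
    have : 0 ≤ ((N + 1 : ℕ) : ℝ) ^ (-α) := by positivity
    have c1 : ((N + 1 : ℕ) : ℝ) ^ (-α) * ((t (N + 1) - t N) ^ (-α) - t (N + 1) ^ (-α))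
        ≤ t (N + 1) ^ (-α) := by
      calc _ ≤ ((N + 1 : ℕ) : ℝ) ^ (-α) * (t (N + 1) / ((N + 1 : ℕ) : ℝ)) ^ (-α) := by
            gcongr; linarith
        _ = _ := b2
    have c2 : 0 ≤ (2 : ℝ) ^ α := by positivity
    rw [mul_assoc]
    exact (mul_le_mul_of_nonneg_left c1 c2).trans (mul_le_mul_of_nonneg_right b3 c0)
  linarith

/-- The step sizes balance the singularity of the second derivative away from the origin. -/
theorem rpow_mul_step_rpow_le {T γ δ r : ℝ} (hT : 0 < T) (hγ : 1 ≤ γ) (hδ : δ ∈ Ioo (0 : ℝ) 2)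
    (hr : 0 ≤ r) {M j : ℕ} (hM : 1 ≤ M) (hj : 1 ≤ j) :
    gradedTime T γ M j ^ (δ - 2) * (gradedTime T γ M (j + 1) - gradedTime T γ M j) ^ r
      ≤ (2 ^ γ) ^ (2 - δ) * γ ^ r
        * (gradedTime T γ M (j + 1) ^ (δ - 2 + r) * ((j + 1 : ℕ) : ℝ) ^ (-r)) := by
  set t := gradedTime T γ M
  have h1 : 0 < t j := gradedTime_pos hT hM hj
  have h2 : 0 < t (j + 1) := gradedTime_pos hT hM (by omega)
  have h3 : t j < t (j + 1) := gradedTime_strictMono hT hγ hM (by omega)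
  have h4 : t (j + 1) ≤ 2 ^ γ * t j := gradedTime_succ_le hT hγ hM hj
  have h5 := gradedTime_step_le hT hγ hM j
  have hj' : (0 : ℝ) < ((j + 1 : ℕ) : ℝ) := by positivity
  have hγ0 : 0 < γ := by linarith
  have a1 : t j ^ (δ - 2) ≤ (2 ^ γ) ^ (2 - δ) * t (j + 1) ^ (δ - 2) := by
    have e : (2 ^ γ) ^ (2 - δ) * t (j + 1) ^ (δ - 2) = (t (j + 1) / 2 ^ γ) ^ (δ - 2) := by
      rw [Real.div_rpow h2.le (by positivity), show 2 - δ = -(δ - 2) by ring,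
        Real.rpow_neg (by positivity)]
      field_simp
    rw [e]
    refine Real.rpow_le_rpow_of_nonpos (by positivity) ?_ (by linarith [hδ.2])
    rw [div_le_iff₀ (by positivity)]; linarith
  have a2 : (t (j + 1) - t j) ^ r ≤ γ ^ r * (t (j + 1) ^ r * ((j + 1 : ℕ) : ℝ) ^ (-r)) := by
    have e : γ ^ r * (t (j + 1) ^ r * ((j + 1 : ℕ) : ℝ) ^ (-r))
        = (γ * t (j + 1) / ((j + 1 : ℕ) : ℝ)) ^ r := by
      rw [Real.div_rpow (by positivity) hj'.le, Real.mul_rpow hγ0.le h2.le, Real.rpow_neg hj'.le]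
      ring
    rw [e]
    refine Real.rpow_le_rpow (by linarith) ?_ hr
    push_cast; exact h5
  calc _ ≤ (2 ^ γ) ^ (2 - δ) * t (j + 1) ^ (δ - 2)
        * (γ ^ r * (t (j + 1) ^ r * ((j + 1 : ℕ) : ℝ) ^ (-r))) :=
        mul_le_mul a1 a2 (Real.rpow_nonneg (by linarith) _) (by positivity)
    _ = _ := by rw [Real.rpow_add h2]; ring

/-- The constant is chosen before f and K, so that the bound can be applied uniformly over the
points of space. The factor t_n^{-α} is kept because stability compensates for exactly this growth.
-/
theorem exists_truncation_bound {T γ δ α : ℝ} (hT : 0 < T) (hγ : 1 ≤ γ)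
    (hα : α ∈ Ioo (0 : ℝ) 1) (hδ : δ ∈ Ioo (0 : ℝ) 2) (hδ1 : δ ≠ 1) :
    ∃ C : ℝ, 0 ≤ C ∧ ∀ (K : ℝ) (f f1 f2 : ℝ → ℝ) (M n : ℕ), 0 ≤ K → 1 ≤ M → 1 ≤ n → n ≤ M →
      ContinuousOn f (Icc 0 (gradedTime T γ M n)) →
      (∀ s ∈ Ioo 0 (gradedTime T γ M n), HasDerivAt f (f1 s) s) →
      (∀ s ∈ Ioo 0 (gradedTime T γ M n), HasDerivAt f1 (f2 s) s) →
      (∀ s ∈ Ioo 0 (gradedTime T γ M n), |f2 s| ≤ K * s ^ (δ - 2)) →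
      |caputo α f (gradedTime T γ M n)
          - l1Diff α (gradedTime T γ M) n (fun j => f (gradedTime T γ M j))|
        ≤ C * K * gradedTime T γ M n ^ (-α) * (M : ℝ) ^ (-min (2 - α) (γ * δ)) := by
  have hα0 := hα.1
  have hα1 : 0 < 1 - α := sub_pos.2 hα.2
  have hδ0 := hδ.1
  have hδ1' : 0 < |δ - 1| := abs_pos.2 (sub_ne_zero.2 hδ1)
  have hγ0 : 0 < γ := by linarith
  have hG : 0 < Real.Gamma (1 - α) := Real.Gamma_pos_of_pos hα1
  set c := ((2 : ℝ) ^ γ) ^ (2 - δ)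
  have hc : 0 ≤ c := by positivity
  -- `Ca` controls the interpolation error, its first summand for the interval at 0 and its second
  -- for the others. `Cb` controls the last interval, its first summand for n ≥ 2 and its second for
  -- n = 1.
  set Ca := (2 / δ + 4) / |δ - 1| + c * γ ^ (2 : ℝ)
  have hCa : 0 ≤ Ca := by positivity
  have hCa1 : (2 / δ + 4) / |δ - 1| ≤ Ca := le_add_of_nonneg_right (by positivity)
  have hCa2 : c * γ ^ (2 : ℝ) ≤ Ca :=
    le_add_of_nonneg_left (b := (2 / δ + 4) / |δ - 1|) (by positivity)
  set Cb := c * γ ^ (2 - α) / (1 - α) + (1 / δ + 4) / |δ - 1| * (2 / δ + 3 / (1 - α))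
  have hCb : 0 ≤ Cb := by positivity
  have hCb1 : c * γ ^ (2 - α) / (1 - α) ≤ Cb := le_add_of_nonneg_right (by positivity)
  have hCb2 : (1 / δ + 4) / |δ - 1| * (2 / δ + 3 / (1 - α)) ≤ Cb :=
    le_add_of_nonneg_left (b := c * γ ^ (2 - α) / (1 - α)) (by positivity)
  refine ⟨1 / Real.Gamma (1 - α) * (T ^ δ * (6 * Ca + Cb)), by positivity, ?_⟩
  intro K f f1 f2 M n hK0 hM hn hnM hf h1 h2 hK
  obtain ⟨N, rfl⟩ : ∃ N, n = N + 1 := ⟨n - 1, by omega⟩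
  set t := gradedTime T γ M with ht
  set μ := min (2 - α) (γ * δ)
  have hmono : StrictMono t := gradedTime_strictMono hT hγ hM
  have ht0 : t 0 = 0 := gradedTime_zero hγ M
  have htn : 0 < t (N + 1) := gradedTime_pos hT hM (by omega)
  have hM' : 0 ≤ (M : ℝ) ^ (-μ) := by positivity
  have hμ : ∀ x : ℕ, 1 ≤ x → x ≤ M → t x ^ δ * (x : ℝ) ^ (-(2 - α)) ≤ T ^ δ * (M : ℝ) ^ (-μ) :=
    fun x hx hxM => gradedTime_rpow_mul_le hT hM hx hxM
  have sub : ∀ j ≤ N, Icc (t j) (t (j + 1)) ⊆ Icc 0 (t (N + 1)) := fun j hj =>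
    Icc_subset_Icc (ht0 ▸ hmono.monotone (Nat.zero_le j)) (hmono.monotone (by omega))
  have sub' : ∀ j ≤ N, Ioo (t j) (t (j + 1)) ⊆ Ioo 0 (t (N + 1)) := fun j hj =>
    Ioo_subset_Ioo (ht0 ▸ hmono.monotone (Nat.zero_le j)) (hmono.monotone (by omega))
  -- As δ < 2, the power s^{δ-2} is largest at the left end point, which is positive for j ≥ 1.
  have hH : ∀ j ≤ N, 1 ≤ j → ∀ s ∈ Ioo (t j) (t (j + 1)), |f2 s| ≤ K * t j ^ (δ - 2) :=
    fun j hj hj1 s hs => (hK s (sub' j hj hs)).trans <| mul_le_mul_of_nonneg_left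
      (Real.rpow_le_rpow_of_nonpos (gradedTime_pos hT hM hj1) hs.1.le (by linarith [hδ.2])) hK0
  have hK0' : ∀ s ∈ Ioo 0 (t 1), |f2 s| ≤ K * s ^ (δ - 2) := fun s hs =>
    hK s (sub' 0 (Nat.zero_le N) (by simpa [ht0] using hs))
  have hfirst : ContinuousOn f (Icc 0 (t 1)) ∧ (∀ s ∈ Ioo 0 (t 1), HasDerivAt f (f1 s) s) ∧
      ∀ s ∈ Ioo 0 (t 1), HasDerivAt f1 (f2 s) s := by
    have s1 := sub 0 (Nat.zero_le N)
    have s2 := sub' 0 (Nat.zero_le N)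
    rw [ht0, zero_add] at s1 s2
    exact ⟨hf.mono s1, fun s hs => h1 s (s2 hs), fun s hs => h2 s (s2 hs)⟩
  have ht1 : 0 < t 1 := gradedTime_pos hT hM le_rfl
  have hM1 := hμ 1 le_rfl (by omega)
  rw [Nat.cast_one, Real.one_rpow, mul_one] at hM1
  -- the interpolation error
  have hg : ∀ j ≤ N, ∀ s ∈ Icc (t j) (t (j + 1)),
      |f s - f (t j) - (f (t (j + 1)) - f (t j)) / (t (j + 1) - t j) * (s - t j)|
        ≤ K * Ca * (T ^ δ * (M : ℝ) ^ (-μ)) * ((j : ℝ) + 1) ^ (-α) := by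
    intro j hj s hs
    rcases Nat.eq_zero_or_pos j with rfl | hj1
    · rw [ht0, zero_add] at hs ⊢
      rw [sub_zero, sub_zero, Nat.cast_zero, zero_add, Real.one_rpow, mul_one]
      refine (abs_sub_linear_le_initial ht1 hδ hδ1 hK0 hfirst.1 hfirst.2.1 hfirst.2.2 hK0' hs).trans
        ?_
      calc _ = K * ((2 / δ + 4) / |δ - 1|) * t 1 ^ δ := by ring
        _ ≤ K * Ca * (T ^ δ * (M : ℝ) ^ (-μ)) := by gcongr
    · refine (abs_sub_linear_le (hmono (Nat.lt_succ_self j)) (hf.mono (sub j hj))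
        (fun s hs => h1 s (sub' j hj hs)) (fun s hs => h2 s (sub' j hj hs)) (hH j hj hj1) hs).trans ?_
      have a1 := rpow_mul_step_rpow_le hT hγ hδ zero_le_two hM hj1
      have a2 := hμ (j + 1) (by omega) (by omega)
      rw [← ht, sub_add_cancel, Real.rpow_two] at a1
      have hj' : (0 : ℝ) < ((j + 1 : ℕ) : ℝ) := by positivity
      have htj : 0 < t (j + 1) := gradedTime_pos hT hM (by omega)
      -- The squared step gives (j+1)^{-2}. The part with exponent -(2-α) goes into the rate M^{-μ};
      -- the part with exponent -α is saved for the sum over the kernel.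
      have e : ((j + 1 : ℕ) : ℝ) ^ (-2 : ℝ)
          = ((j + 1 : ℕ) : ℝ) ^ (-(2 - α)) * ((j : ℝ) + 1) ^ (-α) := by
        rw [show (j : ℝ) + 1 = ((j + 1 : ℕ) : ℝ) by push_cast; rfl, ← Real.rpow_add hj']
        congr 1; ring
      calc _ = K * (t j ^ (δ - 2) * (t (j + 1) - t j) ^ 2) := by ring
        _ ≤ K * (c * γ ^ (2 : ℝ) * (t (j + 1) ^ δ * ((j + 1 : ℕ) : ℝ) ^ (-2 : ℝ))) := by gcongr
        _ = K * (c * γ ^ (2 : ℝ)) * (t (j + 1) ^ δ * ((j + 1 : ℕ) : ℝ) ^ (-(2 - α)))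
            * ((j : ℝ) + 1) ^ (-α) := by rw [e]; ring
        _ ≤ K * Ca * (T ^ δ * (M : ℝ) ^ (-μ)) * ((j : ℝ) + 1) ^ (-α) := by gcongr
  have hi1 := intervalIntegrable_deriv htn hδ hδ1 h2 hK
  have hE : ∀ j ∈ Finset.range N, |∫ s in (t j)..(t (j + 1)), (t (N + 1) - s) ^ (-α)
        * (f1 s - (f (t (j + 1)) - f (t j)) / (t (j + 1) - t j))|
      ≤ K * Ca * (T ^ δ * (M : ℝ) ^ (-μ)) * (((j : ℝ) + 1) ^ (-α)
        * ∫ s in (t j)..(t (j + 1)), α * (t (N + 1) - s) ^ (-α - 1)) := by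
    intro j hj
    have hjN := Finset.mem_range.1 hj
    have hjj : t j < t (j + 1) := hmono (Nat.lt_succ_self j)
    rw [← mul_assoc]
    have hjj' : t (j + 1) - t j ≠ 0 := (sub_pos.2 hjj).ne'
    refine abs_integral_kernel_mul_deriv_le_of_zero hα0 hjj.le (hmono (by omega))
      (g := fun s => f s - f (t j) - (f (t (j + 1)) - f (t j)) / (t (j + 1) - t j) * (s - t j))
      ?_ (fun s hs => hasDerivAt_sub_linear (h1 s (sub' j hjN.le hs)) _ _ _) ?_ (by simp) (by field_simp; ring)
      (hg j hjN.le)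
    · have := hf.mono (sub j hjN.le)
      fun_prop
    · refine IntervalIntegrable.sub (hi1.mono_set ?_) intervalIntegrable_const
      rw [uIcc_of_le hjj.le, uIcc_of_le htn.le]
      exact sub j hjN.le
  -- Integration by parts is impossible up to s = t_n, so the derivative of the interpolation error
  -- is estimated instead. For N = 0 this interval also touches the initial singularity.
  have hlast : |∫ s in (t N)..(t (N + 1)), (t (N + 1) - s) ^ (-α)
        * (f1 s - (f (t (N + 1)) - f (t N)) / (t (N + 1) - t N))|
      ≤ K * Cb * (T ^ δ * (M : ℝ) ^ (-μ)) * t (N + 1) ^ (-α) := by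
    rcases Nat.eq_zero_or_pos N with rfl | hN
    · rw [ht0, zero_add, sub_zero]
      refine (abs_integral_kernel_mul_le_initial ht1 hα hδ (K := K / |δ - 1| * (1 / δ + 4))
        (by positivity) fun s hs =>
          abs_deriv_sub_slope_le_initial ht1 hδ hδ1 hK0 hfirst.1 hfirst.2.1 hfirst.2.2 hK0' hs).trans
          ?_
      calc _ = K * ((1 / δ + 4) / |δ - 1| * (2 / δ + 3 / (1 - α))) * t 1 ^ δ * t 1 ^ (-α) := by
            rw [show δ - α = δ + -α by ring, Real.rpow_add ht1]; ring
        _ ≤ _ := by gcongr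
    · have hNN : t N < t (N + 1) := hmono (Nat.lt_succ_self N)
      refine (abs_integral_kernel_mul_le hα.2 hNN.le fun s hs => abs_deriv_sub_slope_le hNN
        (hf.mono (sub N le_rfl)) (fun s hs => h1 s (sub' N le_rfl hs))
        (fun s hs => h2 s (sub' N le_rfl hs)) (hH N le_rfl hN) hs).trans ?_
      have a1 := rpow_mul_step_rpow_le hT hγ hδ (by linarith : 0 ≤ 2 - α) hM hN
      have a2 := hμ (N + 1) (by omega) (by omega)
      have hd : 0 < t (N + 1) - t N := sub_pos.2 hNN
      rw [← ht] at a1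
      calc _ = K / (1 - α) * (t N ^ (δ - 2) * (t (N + 1) - t N) ^ (2 - α)) := by
            rw [show 2 - α = 1 + (1 - α) by ring, Real.rpow_add hd, Real.rpow_one]; ring
        _ ≤ K / (1 - α) * (c * γ ^ (2 - α)
            * (t (N + 1) ^ (δ - 2 + (2 - α)) * ((N + 1 : ℕ) : ℝ) ^ (-(2 - α)))) := by gcongr
        _ = K * (c * γ ^ (2 - α) / (1 - α)) * (t (N + 1) ^ δ * ((N + 1 : ℕ) : ℝ) ^ (-(2 - α)))
            * t (N + 1) ^ (-α) := by
          rw [show δ - 2 + (2 - α) = δ + -α by ring, Real.rpow_add htn]; ring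
        _ ≤ _ := by gcongr
  rw [caputo_sub_l1Diff_eq (by omega) hα hδ hδ1 hK0 hmono ht0 h1 h2 hK, abs_mul,
    abs_of_pos (by positivity : (0:ℝ) < 1 / Real.Gamma (1 - α)), Finset.sum_range_succ]
  have hsum := sum_rpow_mul_integral_kernel_deriv_le hT hγ hα N hM
  rw [← ht] at hsum
  have hX : 0 ≤ K * Ca * (T ^ δ * (M : ℝ) ^ (-μ)) := by positivity
  calc _ ≤ 1 / Real.Gamma (1 - α) * (K * Ca * (T ^ δ * (M : ℝ) ^ (-μ)) * (6 * t (N + 1) ^ (-α))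
        + K * Cb * (T ^ δ * (M : ℝ) ^ (-μ)) * t (N + 1) ^ (-α)) := by
        refine mul_le_mul_of_nonneg_left ?_ (by positivity)
        refine (abs_add_le _ _).trans (add_le_add ?_ hlast)
        refine (Finset.abs_sum_le_sum_abs _ _).trans ((Finset.sum_le_sum hE).trans ?_)
        rw [← Finset.mul_sum]
        exact mul_le_mul_of_nonneg_left hsum hX
    _ = _ := by ring

/-! ### Integrals over cells -/

section cells

set_option linter.unusedSectionVars false

variable {Nx Ny k : ℕ} (m : RectMesh Nx Ny)

namespace RectMesh

theorem xl_lt_xr (i : Fin Nx) : m.xl i < m.xr i := m.x_strictMono (Fin.castSucc_lt_succ)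

theorem yl_lt_yr (j : Fin Ny) : m.yl j < m.yr j := m.y_strictMono (Fin.castSucc_lt_succ)

theorem measurableSet_cell (i : Fin Nx) (j : Fin Ny) : MeasurableSet (m.cell i j) :=
  measurableSet_Ioo.prod measurableSet_Ioo

theorem isOpen_cell (i : Fin Nx) (j : Fin Ny) : IsOpen (m.cell i j) := isOpen_Ioo.prod isOpen_Ioo

theorem cell_subset_domain (i : Fin Nx) (j : Fin Ny) : m.cell i j ⊆ m.domain :=
  prod_mono
    (Ioo_subset_Ioo (m.x_strictMono.monotone (Fin.zero_le _))
      (m.x_strictMono.monotone (Fin.le_last _)))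
    (Ioo_subset_Ioo (m.y_strictMono.monotone (Fin.zero_le _))
      (m.y_strictMono.monotone (Fin.le_last _)))

theorem volume_cell_ne_top (i : Fin Nx) (j : Fin Ny) : volume (m.cell i j) ≠ ⊤ := by
  rw [cell, Measure.volume_eq_prod, Measure.prod_prod]
  exact ENNReal.mul_ne_top (by simp) (by simp)

theorem integrableOn_cell {F : ℝ × ℝ → ℝ} (hF : Continuous F) (i : Fin Nx) (j : Fin Ny) :
    IntegrableOn F (m.cell i j) :=
  (hF.continuousOn.integrableOn_compact (isCompact_Icc.prod isCompact_Icc)).mono_set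
    (prod_mono Ioo_subset_Icc_self Ioo_subset_Icc_self)

theorem integral_cell {F : ℝ × ℝ → ℝ} (hF : Continuous F) (i : Fin Nx) (j : Fin Ny) :
    ∫ z in m.cell i j, F z
      = ∫ x in (m.xl i)..(m.xr i), ∫ y in (m.yl j)..(m.yr j), F (x, y) := by
  have h := m.integrableOn_cell hF i j
  rw [cell, Measure.volume_eq_prod] at h ⊢
  rw [setIntegral_prod _ h, intervalIntegral.integral_of_le (m.xl_lt_xr i).le,
    integral_Ioc_eq_integral_Ioo]
  simp_rw [intervalIntegral.integral_of_le (m.yl_lt_yr j).le, integral_Ioc_eq_integral_Ioo]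

theorem integral_cell_symm {F : ℝ × ℝ → ℝ} (hF : Continuous F) (i : Fin Nx) (j : Fin Ny) :
    ∫ z in m.cell i j, F z
      = ∫ y in (m.yl j)..(m.yr j), ∫ x in (m.xl i)..(m.xr i), F (x, y) := by
  have h : IntegrableOn (fun z : ℝ × ℝ => F z.swap)
      (Ioo (m.yl j) (m.yr j) ×ˢ Ioo (m.xl i) (m.xr i)) (volume.prod volume) :=
    ((hF.comp continuous_swap).continuousOn.integrableOn_compact
      (isCompact_Icc.prod isCompact_Icc)).mono_set
        (prod_mono Ioo_subset_Icc_self Ioo_subset_Icc_self)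
  rw [cell, Measure.volume_eq_prod, ← setIntegral_prod_swap,
    setIntegral_prod _ h, intervalIntegral.integral_of_le (m.yl_lt_yr j).le,
    integral_Ioc_eq_integral_Ioo]
  simp_rw [intervalIntegral.integral_of_le (m.xl_lt_xr i).le, integral_Ioc_eq_integral_Ioo]
  rfl

end RectMesh

/-! ### Polynomials of degree at most k in each variable -/

namespace LocalQ

theorem continuous_eval (c : LocalQ k) : Continuous c.eval := by
  unfold eval; fun_prop

theorem continuous_uncurry_eval : Continuous fun q : LocalQ k × (ℝ × ℝ) => q.1.eval q.2 := by
  unfold eval; fun_prop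

theorem eval_sub (c d : LocalQ k) (z : ℝ × ℝ) : (c - d).eval z = c.eval z - d.eval z := by
  simp [eval, sub_mul, Finset.sum_sub_distrib]

theorem eval_add (c d : LocalQ k) (z : ℝ × ℝ) : (c + d).eval z = c.eval z + d.eval z := by
  simp [eval, add_mul, Finset.sum_add_distrib]

theorem eval_smul (r : ℝ) (c : LocalQ k) (z : ℝ × ℝ) : (r • c).eval z = r * c.eval z := by
  simp [eval, Finset.mul_sum, mul_assoc]

theorem hasDerivAt_eval_fst (c : LocalQ k) (x y : ℝ) : HasDerivAt (fun s => c.eval (s, y))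
    (∑ a : Fin (k + 1), ∑ b : Fin (k + 1),
      c a b * ((a : ℕ) * x ^ ((a : ℕ) - 1)) * y ^ (b : ℕ)) x := by
  unfold eval
  refine HasDerivAt.fun_sum fun a _ => HasDerivAt.fun_sum fun b _ => ?_
  exact ((hasDerivAt_pow (a : ℕ) x).const_mul (c a b)).mul_const (y ^ (b : ℕ))

theorem hasDerivAt_eval_snd (c : LocalQ k) (x y : ℝ) : HasDerivAt (fun s => c.eval (x, s))
    (∑ a : Fin (k + 1), ∑ b : Fin (k + 1),
      c a b * x ^ (a : ℕ) * ((b : ℕ) * y ^ ((b : ℕ) - 1))) y := by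
  unfold eval
  refine HasDerivAt.fun_sum fun a _ => HasDerivAt.fun_sum fun b _ => ?_
  exact (hasDerivAt_pow (b : ℕ) y).const_mul (c a b * x ^ (a : ℕ))

theorem hasDerivAt_dx (c : LocalQ k) (x y : ℝ) :
    HasDerivAt (fun s => c.eval (s, y)) (c.dx (x, y)) x :=
  (c.hasDerivAt_eval_fst x y).differentiableAt.hasDerivAt

theorem hasDerivAt_dy (c : LocalQ k) (x y : ℝ) :
    HasDerivAt (fun s => c.eval (x, s)) (c.dy (x, y)) y :=
  (c.hasDerivAt_eval_snd x y).differentiableAt.hasDerivAt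

theorem continuous_dx (c : LocalQ k) : Continuous c.dx := by
  have : c.dx = fun z : ℝ × ℝ => ∑ a : Fin (k + 1), ∑ b : Fin (k + 1),
      c a b * ((a : ℕ) * z.1 ^ ((a : ℕ) - 1)) * z.2 ^ (b : ℕ) :=
    funext fun z => (c.hasDerivAt_eval_fst z.1 z.2).deriv
  rw [this]; fun_prop

theorem continuous_dy (c : LocalQ k) : Continuous c.dy := by
  have : c.dy = fun z : ℝ × ℝ => ∑ a : Fin (k + 1), ∑ b : Fin (k + 1),
      c a b * z.1 ^ (a : ℕ) * ((b : ℕ) * z.2 ^ ((b : ℕ) - 1)) :=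
    funext fun z => (c.hasDerivAt_eval_snd z.1 z.2).deriv
  rw [this]; fun_prop

theorem continuous_eval_left (c : LocalQ k) (x : ℝ) : Continuous fun s => c.eval (x, s) :=
  c.continuous_eval.comp (by fun_prop)

theorem continuous_eval_right (c : LocalQ k) (y : ℝ) : Continuous fun s => c.eval (s, y) :=
  c.continuous_eval.comp (by fun_prop)

theorem coeff_eq_zero_of_infinite {d : Fin (k + 1) → ℝ} {S : Set ℝ} (hS : S.Infinite)
    (h : ∀ x ∈ S, ∑ a, d a * x ^ (a : ℕ) = 0) : d = 0 := by
  classical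
  set P : Polynomial ℝ := ∑ a : Fin (k + 1), Polynomial.C (d a) * Polynomial.X ^ (a : ℕ)
  have hP : P = 0 := by
    refine P.eq_zero_of_infinite_isRoot (hS.mono fun x hx => ?_)
    simpa [P, Polynomial.IsRoot, Polynomial.eval_finsetSum] using! h x hx
  funext b
  have : P.coeff b = d b := by
    simp only [P, Polynomial.finsetSum_coeff, Polynomial.coeff_C_mul_X_pow]
    rw [Finset.sum_eq_single b]
    · simp
    · intro a _ hab
      rw [if_neg]
      exact fun h => hab (Fin.ext h.symm)
    · simp
  rw [← this, hP]; simp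

/-- One variable at a time: for fixed y the coefficients of the powers of x vanish, and these are
polynomials in y. This makes the broken norm definite. -/
theorem eq_zero_of_eval_eq_zero {c : LocalQ k} {A B : Set ℝ} (hA : A.Infinite) (hB : B.Infinite)
    (h : ∀ z ∈ A ×ˢ B, c.eval z = 0) : c = 0 := by
  have h1 : ∀ y ∈ B, (fun a => ∑ b : Fin (k + 1), c a b * y ^ (b : ℕ)) = 0 := by
    intro y hy
    refine coeff_eq_zero_of_infinite hA fun x hx => ?_
    rw [← h (x, y) ⟨hx, hy⟩, eval]
    refine Finset.sum_congr rfl fun a _ => ?_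
    rw [Finset.sum_mul]
    exact Finset.sum_congr rfl fun b _ => by ring
  funext a
  exact coeff_eq_zero_of_infinite hB fun y hy => congrFun (h1 y hy) a

end LocalQ

/-! ### The broken `L²` norm -/

theorem cellInner_self_nonneg (i : Fin Nx) (j : Fin Ny) (f : ℝ × ℝ → ℝ) :
    0 ≤ m.cellInner i j f f := integral_nonneg fun z => mul_self_nonneg (f z)

theorem cellInner_self_smul (i : Fin Nx) (j : Fin Ny) (r : ℝ) (c : LocalQ k) :
    m.cellInner i j (r • c).eval (r • c).eval = r ^ 2 * m.cellInner i j c.eval c.eval := by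
  unfold RectMesh.cellInner
  rw [← integral_const_mul]
  congr 1; funext z; rw [LocalQ.eval_smul]; ring

theorem eq_zero_of_cellInner_self {i : Fin Nx} {j : Fin Ny} {c : LocalQ k}
    (h : m.cellInner i j c.eval c.eval = 0) : c = 0 := by
  have hc : Continuous fun z => c.eval z * c.eval z := c.continuous_eval.mul c.continuous_eval
  unfold RectMesh.cellInner at h
  rw [setIntegral_eq_zero_iff_of_nonneg_ae (ae_of_all _ fun z => mul_self_nonneg _)
    (m.integrableOn_cell hc i j)] at h
  have h' := Measure.eqOn_open_of_ae_eq h (m.isOpen_cell i j) hc.continuousOn continuousOn_const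
  exact LocalQ.eq_zero_of_eval_eq_zero (Ioo_infinite (m.xl_lt_xr i)) (Ioo_infinite (m.yl_lt_yr j))
    fun z hz => mul_self_eq_zero.1 (h' hz)

theorem continuous_cellInner_self (i : Fin Nx) (j : Fin Ny) :
    Continuous fun c : LocalQ k => m.cellInner i j c.eval c.eval := by
  have : (fun c : LocalQ k => m.cellInner i j c.eval c.eval) = fun c =>
      ∫ x in (m.xl i)..(m.xr i), ∫ y in (m.yl j)..(m.yr j), c.eval (x, y) * c.eval (x, y) :=
    funext fun c => m.integral_cell (c.continuous_eval.mul c.continuous_eval) i j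
  rw [this]
  refine intervalIntegral.continuous_parametric_intervalIntegral_of_continuous'
    (f := fun (c : LocalQ k) (x : ℝ) => ∫ y in (m.yl j)..(m.yr j), c.eval (x, y) * c.eval (x, y)) ?_ _ _
  refine intervalIntegral.continuous_parametric_intervalIntegral_of_continuous'
    (f := fun (q : LocalQ k × ℝ) y => q.1.eval (q.2, y) * q.1.eval (q.2, y)) ?_ _ _
  have h : Continuous fun r : (LocalQ k × ℝ) × ℝ => r.1.1.eval (r.1.2, r.2) :=
    LocalQ.continuous_uncurry_eval.comp
      (g := fun q : LocalQ k × (ℝ × ℝ) => q.1.eval q.2)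
      (f := fun r : (LocalQ k × ℝ) × ℝ => (r.1.1, (r.1.2, r.2))) (by fun_prop)
  exact h.mul h

theorem sum_cellInner_nonneg (v : DGSpace Nx Ny k) :
    0 ≤ ∑ i : Fin Nx, ∑ j : Fin Ny, m.cellInner i j (v i j).eval (v i j).eval :=
  Finset.sum_nonneg fun i _ => Finset.sum_nonneg fun j _ => cellInner_self_nonneg m i j _

theorem dgNorm_sq (v : DGSpace Nx Ny k) : dgNorm m v ^ 2
    = ∑ i : Fin Nx, ∑ j : Fin Ny, m.cellInner i j (v i j).eval (v i j).eval :=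
  Real.sq_sqrt (sum_cellInner_nonneg m v)

theorem dgNorm_nonneg (v : DGSpace Nx Ny k) : 0 ≤ dgNorm m v := Real.sqrt_nonneg _

theorem dgNorm_smul (r : ℝ) (v : DGSpace Nx Ny k) : dgNorm m (r • v) = |r| * dgNorm m v := by
  unfold dgNorm
  rw [← Real.sqrt_sq_eq_abs, ← Real.sqrt_mul (sq_nonneg r), Finset.mul_sum]
  congr 1
  refine Finset.sum_congr rfl fun i _ => ?_
  rw [Finset.mul_sum]
  exact Finset.sum_congr rfl fun j _ => cellInner_self_smul m i j r (v i j)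

theorem eq_zero_of_dgNorm_eq_zero {v : DGSpace Nx Ny k} (h : dgNorm m v = 0) : v = 0 := by
  have h2 := dgNorm_sq m v
  rw [h, zero_pow two_ne_zero, eq_comm, Finset.sum_eq_zero_iff_of_nonneg fun i _ =>
    Finset.sum_nonneg fun j _ => cellInner_self_nonneg m i j _] at h2
  funext i j
  have h3 := h2 i (Finset.mem_univ i)
  rw [Finset.sum_eq_zero_iff_of_nonneg fun j _ => cellInner_self_nonneg m i j _] at h3
  exact eq_zero_of_cellInner_self m (h3 j (Finset.mem_univ j))

theorem continuous_dgNorm : Continuous (dgNorm m : DGSpace Nx Ny k → ℝ) := by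
  refine Real.continuous_sqrt.comp ?_
  refine continuous_finsetSum _ fun i _ => continuous_finsetSum _ fun j _ => ?_
  exact (continuous_cellInner_self m i j).comp ((continuous_apply j).comp (continuous_apply i))

/-- All norms on `V_h^k` are equivalent. -/
theorem exists_norm_le_dgNorm : ∃ C : ℝ, 0 < C ∧ ∀ v : DGSpace Nx Ny k, ‖v‖ ≤ C * dgNorm m v := by
  -- Continuity, definiteness and homogeneity suffice: a positive lower bound on the unit sphere is
  -- scaled to all of the space.
  obtain ⟨a, ha, h⟩ := (isCompact_sphere (0 : DGSpace Nx Ny k) 1).exists_forall_le'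
    (continuous_dgNorm m).continuousOn (a := 0) fun v hv =>
      lt_of_le_of_ne (dgNorm_nonneg m v) fun h0 => by
        rw [eq_zero_of_dgNorm_eq_zero m h0.symm] at hv
        simp at hv
  refine ⟨1 / a, by positivity, fun v => ?_⟩
  rcases eq_or_ne v 0 with rfl | hv
  · rw [norm_zero]; have := dgNorm_nonneg m (0 : DGSpace Nx Ny k); positivity
  · have hv' : 0 < ‖v‖ := norm_pos_iff.2 hv
    have := h (‖v‖⁻¹ • v) (by simp [norm_smul, hv'.ne'])
    rw [dgNorm_smul, abs_of_pos (by positivity), inv_mul_eq_div, le_div_iff₀ hv'] at this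
    rw [div_mul_eq_mul_div, one_mul, le_div_iff₀ ha]
    linarith

/-- Point evaluation as a continuous linear functional on `V_h^k`. -/
def evalCLM (i : Fin Nx) (j : Fin Ny) (z : ℝ × ℝ) : DGSpace Nx Ny k →L[ℝ] ℝ :=
  LinearMap.toContinuousLinearMap
    { toFun := fun v => (v i j).eval z
      map_add' := fun v w => LocalQ.eval_add (v i j) (w i j) z
      map_smul' := fun r v => LocalQ.eval_smul r (v i j) z }

/-- The regularity hypothesis is in L², whereas truncation is estimated pointwise in space because κ
varies. On the fixed finite dimensional space the two are equivalent up to a constant. Each local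
polynomial is bounded on the whole domain, not only on its own cell. -/
theorem exists_abs_eval_le : ∃ C : ℝ, 0 < C ∧ ∀ (v : DGSpace Nx Ny k) (i : Fin Nx) (j : Fin Ny),
    ∀ z ∈ m.domain, |(v i j).eval z| ≤ C * dgNorm m v := by
  obtain ⟨C, hC, h⟩ := exists_norm_le_dgNorm (k := k) m
  set W : ℝ × ℝ → ℝ := fun z => ∑ a : Fin (k + 1), ∑ b : Fin (k + 1),
    |z.1 ^ (a : ℕ) * z.2 ^ (b : ℕ)|
  have hW : Continuous W := by fun_prop
  obtain ⟨R, hR⟩ := (isCompact_Icc.prod isCompact_Icc :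
    IsCompact (Icc (m.x 0) (m.x (Fin.last Nx)) ×ˢ Icc (m.y 0) (m.y (Fin.last Ny)))).bddAbove_image
      hW.continuousOn
  refine ⟨C * (|R| + 1), by positivity, fun v i j z hz => ?_⟩
  have hWR : W z ≤ |R| + 1 := by
    have : W z ≤ R := hR ⟨z, prod_mono Ioo_subset_Icc_self Ioo_subset_Icc_self hz, rfl⟩
    linarith [le_abs_self R]
  have hv : ∀ a b, |v i j a b| ≤ ‖v‖ := fun a b =>
    ((norm_le_pi_norm (v i j a) b).trans (norm_le_pi_norm (v i j) a)).trans
      ((norm_le_pi_norm (v i) j).trans (norm_le_pi_norm v i))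
  have h1 : |(v i j).eval z| ≤ ‖v‖ * W z := by
    unfold LocalQ.eval
    refine (Finset.abs_sum_le_sum_abs _ _).trans ?_
    rw [Finset.mul_sum]
    refine Finset.sum_le_sum fun a _ => (Finset.abs_sum_le_sum_abs _ _).trans ?_
    rw [Finset.mul_sum]
    refine Finset.sum_le_sum fun b _ => ?_
    rw [mul_assoc, abs_mul]
    exact mul_le_mul_of_nonneg_right (hv a b) (abs_nonneg _)
  have h2 : 0 ≤ W z := Finset.sum_nonneg fun a _ => Finset.sum_nonneg fun b _ => abs_nonneg _
  calc _ ≤ ‖v‖ * W z := h1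
    _ ≤ C * dgNorm m v * (|R| + 1) := by
      gcongr
      · exact mul_nonneg hC.le (dgNorm_nonneg m v)
      · exact h v
    _ = _ := by ring

/-! ### Integration by parts on cells and the energy identity -/

theorem cellInner_dx_add (c d : LocalQ k) (i : Fin Nx) (j : Fin Ny) :
    m.cellInner i j c.eval d.dx + m.cellInner i j d.eval c.dx
      = ∫ s in (m.yl j)..(m.yr j), (c.eval (m.xr i, s) * d.eval (m.xr i, s)
          - c.eval (m.xl i, s) * d.eval (m.xl i, s)) := by
  unfold RectMesh.cellInner
  have h1 : Continuous fun z => c.eval z * d.dx z := c.continuous_eval.mul d.continuous_dx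
  have h2 : Continuous fun z => d.eval z * c.dx z := d.continuous_eval.mul c.continuous_dx
  have h3 : Continuous fun z => c.eval z * d.dx z + d.eval z * c.dx z := h1.add h2
  rw [← integral_add (m.integrableOn_cell h1 i j) (m.integrableOn_cell h2 i j),
    m.integral_cell_symm h3]
  refine intervalIntegral.integral_congr fun y _ => ?_
  refine intervalIntegral.integral_eq_sub_of_hasDerivAt
    (f := fun x => c.eval (x, y) * d.eval (x, y)) (fun x _ => ?_) ?_
  · convert! (c.hasDerivAt_dx x y).mul (d.hasDerivAt_dx x y) using 1
    ring
  · exact (h3.comp (by fun_prop : Continuous fun x : ℝ => (x, y))).intervalIntegrable _ _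

theorem cellInner_dy_add (c d : LocalQ k) (i : Fin Nx) (j : Fin Ny) :
    m.cellInner i j c.eval d.dy + m.cellInner i j d.eval c.dy
      = ∫ s in (m.xl i)..(m.xr i), (c.eval (s, m.yr j) * d.eval (s, m.yr j)
          - c.eval (s, m.yl j) * d.eval (s, m.yl j)) := by
  unfold RectMesh.cellInner
  have h1 : Continuous fun z => c.eval z * d.dy z := c.continuous_eval.mul d.continuous_dy
  have h2 : Continuous fun z => d.eval z * c.dy z := d.continuous_eval.mul c.continuous_dy
  have h3 : Continuous fun z => c.eval z * d.dy z + d.eval z * c.dy z := h1.add h2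
  rw [← integral_add (m.integrableOn_cell h1 i j) (m.integrableOn_cell h2 i j),
    m.integral_cell h3]
  refine intervalIntegral.integral_congr fun x _ => ?_
  refine intervalIntegral.integral_eq_sub_of_hasDerivAt
    (f := fun y => c.eval (x, y) * d.eval (x, y)) (fun y _ => ?_) ?_
  · convert! (c.hasDerivAt_dy x y).mul (d.hasDerivAt_dy x y) using 1
    ring
  · exact (h3.comp (by fun_prop : Continuous fun y : ℝ => (x, y))).intervalIntegrable _ _

theorem cellInner_sub_left (i : Fin Nx) (j : Fin Ny) (c d : LocalQ k) {g : ℝ × ℝ → ℝ}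
    (hg : Continuous g) : m.cellInner i j (c - d).eval g
      = m.cellInner i j c.eval g - m.cellInner i j d.eval g := by
  unfold RectMesh.cellInner
  have h1 : Continuous fun z => c.eval z * g z := c.continuous_eval.mul hg
  have h2 : Continuous fun z => d.eval z * g z := d.continuous_eval.mul hg
  rw [← integral_sub (m.integrableOn_cell h1 i j) (m.integrableOn_cell h2 i j)]
  simp_rw [LocalQ.eval_sub, sub_mul]

theorem cellInner_add_right (i : Fin Nx) (j : Fin Ny) {f g h : ℝ × ℝ → ℝ} (hf : Continuous f)
    (hg : Continuous g) (hh : Continuous h) : m.cellInner i j f (fun z => g z + h z)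
      = m.cellInner i j f g + m.cellInner i j f h := by
  unfold RectMesh.cellInner
  have h1 : Continuous fun z => f z * g z := hf.mul hg
  have h2 : Continuous fun z => f z * h z := hf.mul hh
  rw [← integral_add (m.integrableOn_cell h1 i j) (m.integrableOn_cell h2 i j)]
  simp_rw [mul_add]

variable [NeZero Nx] [NeZero Ny]

theorem continuous_avgX (σ : ℝ) (v : DGSpace Nx Ny k) (i : Fin Nx) (j : Fin Ny) :
    Continuous (avgX m σ v i j) :=
  (((v i j).continuous_eval_left _).const_mul _).add
    (((v (i + 1) j).continuous_eval_left _).const_mul _)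

theorem continuous_avgY (σ : ℝ) (v : DGSpace Nx Ny k) (i : Fin Nx) (j : Fin Ny) :
    Continuous (avgY m σ v i j) :=
  (((v i j).continuous_eval_right _).const_mul _).add
    (((v i (j + 1)).continuous_eval_right _).const_mul _)

theorem avgX_sub (σ : ℝ) (v w : DGSpace Nx Ny k) (i : Fin Nx) (j : Fin Ny) (s : ℝ) :
    avgX m σ (v - w) i j s = avgX m σ v i j s - avgX m σ w i j s := by
  simp only [avgX, Pi.sub_apply, LocalQ.eval_sub]; ring

theorem avgY_sub (σ : ℝ) (v w : DGSpace Nx Ny k) (i : Fin Nx) (j : Fin Ny) (s : ℝ) :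
    avgY m σ (v - w) i j s = avgY m σ v i j s - avgY m σ w i j s := by
  simp only [avgY, Pi.sub_apply, LocalQ.eval_sub]; ring

/-- The flux integrals of `v` against `w` over the two vertical edges of a cell. -/
def fluxX (σ : ℝ) (v w : DGSpace Nx Ny k) (i : Fin Nx) (j : Fin Ny) : ℝ :=
  ∫ s in (m.yl j)..(m.yr j), (avgX m σ v i j s * (w i j).eval (m.xr i, s)
    - avgX m σ v (i - 1) j s * (w i j).eval (m.xl i, s))

/-- The flux integrals of `v` against `w` over the two horizontal edges of a cell. -/
def fluxY (σ : ℝ) (v w : DGSpace Nx Ny k) (i : Fin Nx) (j : Fin Ny) : ℝ :=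
  ∫ s in (m.xl i)..(m.xr i), (avgY m σ v i j s * (w i j).eval (s, m.yr j)
    - avgY m σ v i (j - 1) s * (w i j).eval (s, m.yl j))

theorem continuous_fluxX_integrand (σ : ℝ) (v w : DGSpace Nx Ny k) (i : Fin Nx) (j : Fin Ny) :
    Continuous fun s => avgX m σ v i j s * (w i j).eval (m.xr i, s)
      - avgX m σ v (i - 1) j s * (w i j).eval (m.xl i, s) :=
  ((continuous_avgX m _ _ _ _).mul ((w i j).continuous_eval_left _)).sub
    ((continuous_avgX m _ _ _ _).mul ((w i j).continuous_eval_left _))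

theorem continuous_fluxY_integrand (σ : ℝ) (v w : DGSpace Nx Ny k) (i : Fin Nx) (j : Fin Ny) :
    Continuous fun s => avgY m σ v i j s * (w i j).eval (s, m.yr j)
      - avgY m σ v i (j - 1) s * (w i j).eval (s, m.yl j) :=
  ((continuous_avgY m _ _ _ _).mul ((w i j).continuous_eval_right _)).sub
    ((continuous_avgY m _ _ _ _).mul ((w i j).continuous_eval_right _))

theorem fluxX_sub (σ : ℝ) (v v' w : DGSpace Nx Ny k) (i : Fin Nx) (j : Fin Ny) :
    fluxX m σ (v - v') w i j = fluxX m σ v w i j - fluxX m σ v' w i j := by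
  unfold fluxX
  rw [← intervalIntegral.integral_sub
    ((continuous_fluxX_integrand m σ v w i j).intervalIntegrable _ _)
    ((continuous_fluxX_integrand m σ v' w i j).intervalIntegrable _ _)]
  refine intervalIntegral.integral_congr fun s _ => ?_
  simp only [avgX_sub]; ring

theorem fluxY_sub (σ : ℝ) (v v' w : DGSpace Nx Ny k) (i : Fin Nx) (j : Fin Ny) :
    fluxY m σ (v - v') w i j = fluxY m σ v w i j - fluxY m σ v' w i j := by
  unfold fluxY
  rw [← intervalIntegral.integral_sub
    ((continuous_fluxY_integrand m σ v w i j).intervalIntegrable _ _)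
    ((continuous_fluxY_integrand m σ v' w i j).intervalIntegrable _ _)]
  refine intervalIntegral.integral_congr fun s _ => ?_
  simp only [avgY_sub]; ring

/-- Regroups a sum over cells as a sum over edges: A belongs to the right (or upper) edge, B to the
left (or lower) one, and the cyclic shift is the periodic boundary condition. -/
theorem sum_add_eq_zero_of_shift {n : ℕ} [NeZero n] {A B : Fin n → ℝ}
    (h : ∀ i, A i + B (i + 1) = 0) : ∑ i, (A i + B i) = 0 := by
  rw [Finset.sum_add_distrib, ← Equiv.sum_comp (Equiv.addRight (1 : Fin n)) B,
    ← Finset.sum_add_distrib]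
  exact Finset.sum_eq_zero fun i _ => h i

/-- With complementary weights the flux terms over vertical edges cancel. -/
theorem sum_fluxX_eq_zero (σ : ℝ) (p v : DGSpace Nx Ny k) (j : Fin Ny) :
    ∑ i, (m.cellInner i j (p i j).eval (v i j).dx + m.cellInner i j (v i j).eval (p i j).dx
      - fluxX m (1 - σ) p v i j - fluxX m σ v p i j) = 0 := by
  set A : Fin Nx → ℝ → ℝ := fun i s =>
    (p i j).eval (m.xr i, s) * (v i j).eval (m.xr i, s)
      - avgX m (1 - σ) p i j s * (v i j).eval (m.xr i, s)
      - avgX m σ v i j s * (p i j).eval (m.xr i, s) with hA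
  set B : Fin Nx → ℝ → ℝ := fun i s =>
    -((p i j).eval (m.xl i, s) * (v i j).eval (m.xl i, s)
      - avgX m (1 - σ) p (i - 1) j s * (v i j).eval (m.xl i, s)
      - avgX m σ v (i - 1) j s * (p i j).eval (m.xl i, s)) with hB
  have cp : ∀ i x, Continuous fun s => (p i j).eval (x, s) := fun i x =>
    (p i j).continuous_eval_left x
  have cv : ∀ i x, Continuous fun s => (v i j).eval (x, s) := fun i x =>
    (v i j).continuous_eval_left x
  have hAc : ∀ i, Continuous (A i) := fun i =>
    (((cp i _).mul (cv i _)).sub ((continuous_avgX m _ _ _ _).mul (cv i _))).sub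
      ((continuous_avgX m _ _ _ _).mul (cp i _))
  have hBc : ∀ i, Continuous (B i) := fun i =>
    ((((cp i _).mul (cv i _)).sub ((continuous_avgX m _ _ _ _).mul (cv i _))).sub
      ((continuous_avgX m _ _ _ _).mul (cp i _))).neg
  have e : ∀ i, m.cellInner i j (p i j).eval (v i j).dx
      + m.cellInner i j (v i j).eval (p i j).dx - fluxX m (1 - σ) p v i j - fluxX m σ v p i j
      = (∫ s in (m.yl j)..(m.yr j), A i s) + ∫ s in (m.yl j)..(m.yr j), B i s := by
    intro i
    rw [cellInner_dx_add, fluxX, fluxX, ← intervalIntegral.integral_sub,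
      ← intervalIntegral.integral_sub, ← intervalIntegral.integral_add]
    · refine intervalIntegral.integral_congr fun s _ => ?_
      simp only [hA, hB]; ring
    · exact (hAc i).intervalIntegrable _ _
    · exact (hBc i).intervalIntegrable _ _
    · exact ((((cp i _).mul (cv i _)).sub ((cp i _).mul (cv i _))).sub
        (continuous_fluxX_integrand m _ p v i j)).intervalIntegrable _ _
    · exact (continuous_fluxX_integrand m _ v p i j).intervalIntegrable _ _
    · exact (((cp i _).mul (cv i _)).sub ((cp i _).mul (cv i _))).intervalIntegrable _ _
    · exact (continuous_fluxX_integrand m _ p v i j).intervalIntegrable _ _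
  rw [Finset.sum_congr rfl fun i _ => e i]
  -- On each edge it remains to see that p⁻v⁻ - p⁺v⁺ = p̂(v⁻ - v⁺) + v̂(p⁻ - p⁺), which holds for
  -- every σ since the weights are complementary.
  refine sum_add_eq_zero_of_shift fun i => ?_
  rw [← intervalIntegral.integral_add ((hAc i).intervalIntegrable _ _)
    ((hBc _).intervalIntegrable _ _)]
  refine intervalIntegral.integral_zero_ae (ae_of_all _ fun s _ => ?_)
  simp only [hA, hB, avgX, add_sub_cancel_right]
  ring

/-- With complementary weights the flux terms over horizontal edges cancel. -/
theorem sum_fluxY_eq_zero (σ : ℝ) (p v : DGSpace Nx Ny k) (i : Fin Nx) :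
    ∑ j, (m.cellInner i j (p i j).eval (v i j).dy + m.cellInner i j (v i j).eval (p i j).dy
      - fluxY m (1 - σ) p v i j - fluxY m σ v p i j) = 0 := by
  set A : Fin Ny → ℝ → ℝ := fun j s =>
    (p i j).eval (s, m.yr j) * (v i j).eval (s, m.yr j)
      - avgY m (1 - σ) p i j s * (v i j).eval (s, m.yr j)
      - avgY m σ v i j s * (p i j).eval (s, m.yr j) with hA
  set B : Fin Ny → ℝ → ℝ := fun j s =>
    -((p i j).eval (s, m.yl j) * (v i j).eval (s, m.yl j)
      - avgY m (1 - σ) p i (j - 1) s * (v i j).eval (s, m.yl j)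
      - avgY m σ v i (j - 1) s * (p i j).eval (s, m.yl j)) with hB
  have cp : ∀ j y, Continuous fun s => (p i j).eval (s, y) := fun j y =>
    (p i j).continuous_eval_right y
  have cv : ∀ j y, Continuous fun s => (v i j).eval (s, y) := fun j y =>
    (v i j).continuous_eval_right y
  have hAc : ∀ j, Continuous (A j) := fun j =>
    (((cp j _).mul (cv j _)).sub ((continuous_avgY m _ _ _ _).mul (cv j _))).sub
      ((continuous_avgY m _ _ _ _).mul (cp j _))
  have hBc : ∀ j, Continuous (B j) := fun j =>
    ((((cp j _).mul (cv j _)).sub ((continuous_avgY m _ _ _ _).mul (cv j _))).sub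
      ((continuous_avgY m _ _ _ _).mul (cp j _))).neg
  have e : ∀ j, m.cellInner i j (p i j).eval (v i j).dy
      + m.cellInner i j (v i j).eval (p i j).dy - fluxY m (1 - σ) p v i j - fluxY m σ v p i j
      = (∫ s in (m.xl i)..(m.xr i), A j s) + ∫ s in (m.xl i)..(m.xr i), B j s := by
    intro j
    rw [cellInner_dy_add, fluxY, fluxY, ← intervalIntegral.integral_sub,
      ← intervalIntegral.integral_sub, ← intervalIntegral.integral_add]
    · refine intervalIntegral.integral_congr fun s _ => ?_
      simp only [hA, hB]; ring
    · exact (hAc j).intervalIntegrable _ _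
    · exact (hBc j).intervalIntegrable _ _
    · exact ((((cp j _).mul (cv j _)).sub ((cp j _).mul (cv j _))).sub
        (continuous_fluxY_integrand m _ p v i j)).intervalIntegrable _ _
    · exact (continuous_fluxY_integrand m _ v p i j).intervalIntegrable _ _
    · exact (((cp j _).mul (cv j _)).sub ((cp j _).mul (cv j _))).intervalIntegrable _ _
    · exact (continuous_fluxY_integrand m _ p v i j).intervalIntegrable _ _
  rw [Finset.sum_congr rfl fun j _ => e j]
  refine sum_add_eq_zero_of_shift fun j => ?_
  rw [← intervalIntegral.integral_add ((hAc j).intervalIntegrable _ _)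
    ((hBc _).intervalIntegrable _ _)]
  refine intervalIntegral.integral_zero_ae (ae_of_all _ fun s _ => ?_)
  simp only [hA, hB, avgY, add_sub_cancel_right]
  ring

/-- Energy inequality: the difference of the time derivatives of two solutions, tested with the
difference of the solutions, is nonpositive. -/
theorem sum_cellInner_sub_le_zero {σ₁ σ₂ : ℝ} {D D' : Fin Nx → Fin Ny → ℝ × ℝ → ℝ}
    {u u' : DGSpace Nx Ny k} {p p' : DGSpace Nx Ny k × DGSpace Nx Ny k}
    (h1 : SchemeEq1 m σ₁ σ₂ D p) (h1' : SchemeEq1 m σ₁ σ₂ D' p')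
    (h2 : SchemeEq2 m σ₁ σ₂ u p) (h2' : SchemeEq2 m σ₁ σ₂ u' p') :
    ∑ i, ∑ j, (m.cellInner i j (D i j) ((u - u') i j).eval
      - m.cellInner i j (D' i j) ((u - u') i j).eval) ≤ 0 := by
  set e := u - u' with he
  set q₁ := p.1 - p'.1 with hq₁
  set q₂ := p.2 - p'.2 with hq₂
  -- Difference of the first equations, tested with e; the boundary term unfolds to `fluxX` plus
  -- `fluxY`.
  have a1 : ∀ i j, m.cellInner i j (D i j) (e i j).eval - m.cellInner i j (D' i j) (e i j).eval
      = -(m.cellInner i j (q₁ i j).eval (e i j).dx - fluxX m (1 - σ₁) q₁ e i j)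
        - (m.cellInner i j (q₂ i j).eval (e i j).dy - fluxY m (1 - σ₂) q₂ e i j) := by
    intro i j
    have b1 : _ - (fluxX m (1 - σ₁) p.1 e i j + fluxY m (1 - σ₂) p.2 e i j) = 0 := h1 e i j
    have b2 : _ - (fluxX m (1 - σ₁) p'.1 e i j + fluxY m (1 - σ₂) p'.2 e i j) = 0 := h1' e i j
    rw [hq₁, hq₂, fluxX_sub, fluxY_sub, Pi.sub_apply, Pi.sub_apply, Pi.sub_apply, Pi.sub_apply,
      cellInner_sub_left m i j _ _ (e i j).continuous_dx,
      cellInner_sub_left m i j _ _ (e i j).continuous_dy]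
    linarith
  -- Difference of the second equations, tested with q = (q₁, q₂) itself.
  have a2 : ∀ i j, 0 = m.cellInner i j (q₁ i j).eval (q₁ i j).eval
        + m.cellInner i j (q₂ i j).eval (q₂ i j).eval
        + (m.cellInner i j (e i j).eval (q₁ i j).dx - fluxX m σ₁ e q₁ i j)
        + (m.cellInner i j (e i j).eval (q₂ i j).dy - fluxY m σ₂ e q₂ i j) := by
    intro i j
    have b1 : _ + _ - (fluxX m σ₁ u q₁ i j + fluxY m σ₂ u q₂ i j) = 0 := h2 (q₁, q₂) i j
    have b2 : _ + _ - (fluxX m σ₁ u' q₁ i j + fluxY m σ₂ u' q₂ i j) = 0 := h2' (q₁, q₂) i j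
    rw [cellInner_add_right m i j (u i j).continuous_eval (q₁ i j).continuous_dx
      (q₂ i j).continuous_dy] at b1
    rw [cellInner_add_right m i j (u' i j).continuous_eval (q₁ i j).continuous_dx
      (q₂ i j).continuous_dy] at b2
    have c1 := cellInner_sub_left m i j (p.1 i j) (p'.1 i j) (q₁ i j).continuous_eval
    have c2 := cellInner_sub_left m i j (p.2 i j) (p'.2 i j) (q₂ i j).continuous_eval
    have c3 := cellInner_sub_left m i j (u i j) (u' i j) (q₁ i j).continuous_dx
    have c4 := cellInner_sub_left m i j (u i j) (u' i j) (q₂ i j).continuous_dy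
    have d1 : fluxX m σ₁ e q₁ i j = _ := fluxX_sub m σ₁ u u' q₁ i j
    have d2 : fluxY m σ₂ e q₂ i j = _ := fluxY_sub m σ₂ u u' q₂ i j
    have c1' : m.cellInner i j (q₁ i j).eval (q₁ i j).eval = _ := c1
    have c2' : m.cellInner i j (q₂ i j).eval (q₂ i j).eval = _ := c2
    have c3' : m.cellInner i j (e i j).eval (q₁ i j).dx = _ := c3
    have c4' : m.cellInner i j (e i j).eval (q₂ i j).dy = _ := c4
    rw [c1', c2', c3', c4', d1, d2]
    linarith
  -- Adding both identities pairs each volume term with its partner from integration by parts. The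
  -- sums are ordered so that the inner one runs across the edges that cancel.
  have a3 : ∑ i, ∑ j, (m.cellInner i j (D i j) (e i j).eval
        - m.cellInner i j (D' i j) (e i j).eval)
      = -(∑ i, ∑ j, (m.cellInner i j (q₁ i j).eval (q₁ i j).eval
          + m.cellInner i j (q₂ i j).eval (q₂ i j).eval))
        - (∑ j, ∑ i, (m.cellInner i j (q₁ i j).eval (e i j).dx
          + m.cellInner i j (e i j).eval (q₁ i j).dx
          - fluxX m (1 - σ₁) q₁ e i j - fluxX m σ₁ e q₁ i j))
        - ∑ i, ∑ j, (m.cellInner i j (q₂ i j).eval (e i j).dy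
          + m.cellInner i j (e i j).eval (q₂ i j).dy
          - fluxY m (1 - σ₂) q₂ e i j - fluxY m σ₂ e q₂ i j) := by
    rw [Finset.sum_comm (s := (Finset.univ : Finset (Fin Ny)))]
    simp only [← Finset.sum_neg_distrib, ← Finset.sum_sub_distrib]
    refine Finset.sum_congr rfl fun i _ => Finset.sum_congr rfl fun j _ => ?_
    linarith [a1 i j, a2 i j]
  rw [a3, Finset.sum_eq_zero fun j _ => sum_fluxX_eq_zero m σ₁ q₁ e j,
    Finset.sum_eq_zero fun i _ => sum_fluxY_eq_zero m σ₂ q₂ e i, sub_zero, sub_zero,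
    neg_nonpos]
  exact Finset.sum_nonneg fun i _ => Finset.sum_nonneg fun j _ =>
    add_nonneg (cellInner_self_nonneg m i j _) (cellInner_self_nonneg m i j _)

/-- Testing both conditions with the difference u - u' cancels the common data term. Hence the error
at time 0 is exactly zero. -/
theorem eq_of_schemeInit {u₀ : ℝ × ℝ → ℝ} {u u' : DGSpace Nx Ny k} (h : SchemeInit m u₀ u)
    (h' : SchemeInit m u₀ u') : u = u' := by
  funext i j
  refine sub_eq_zero.1 (eq_zero_of_cellInner_self m (i := i) (j := j) ?_)
  rw [cellInner_sub_left m i j _ _ (u i j - u' i j).continuous_eval]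
  have h1 := h (u - u') i j
  have h2 := h' (u - u') i j
  simp only [Pi.sub_apply] at h1 h2
  rw [h1, h2, sub_self]

end cells

/-! ### Truncation error of the substantial derivative along the semi-discrete solution -/

theorem hasDerivAt_exp_mul {φ φ1 : ℝ → ℝ} {κ s : ℝ} (h : HasDerivAt φ (φ1 s) s) :
    HasDerivAt (fun s => Real.exp (κ * s) * φ s) (Real.exp (κ * s) * (κ * φ s + φ1 s)) s := by
  have h0 : HasDerivAt (fun s => Real.exp (κ * s)) (Real.exp (κ * s) * κ) s := by
    simpa using ((hasDerivAt_id s).const_mul κ).exp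
  convert! h0.mul h using 1
  ring

theorem hasDerivAt_exp_mul_deriv {φ φ1 φ2 : ℝ → ℝ} {κ s : ℝ} (h : HasDerivAt φ (φ1 s) s)
    (h' : HasDerivAt φ1 (φ2 s) s) :
    HasDerivAt (fun s => Real.exp (κ * s) * (κ * φ s + φ1 s))
      (Real.exp (κ * s) * (κ ^ 2 * φ s + 2 * κ * φ1 s + φ2 s)) s := by
  convert! hasDerivAt_exp_mul (κ := κ) (φ1 := fun s => κ * φ1 s + φ2 s)
    ((h.const_mul κ).add h') using 1
  simp only [Pi.add_apply]
  ring

theorem exp_mul_le {κ b s T : ℝ} (hκ : |κ| ≤ b) (hs : |s| ≤ T) :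
    Real.exp (κ * s) ≤ Real.exp (b * T) := by
  rw [Real.exp_le_exp]
  calc κ * s ≤ |κ * s| := le_abs_self _
    _ = |κ| * |s| := abs_mul _ _
    _ ≤ b * T := mul_le_mul hκ hs (abs_nonneg _) ((abs_nonneg _).trans hκ)

/-- On (0,T) the most singular power dominates the others: 1 ≤ T^{2-δ} s^{δ-2} and s^{δ-1} ≤ T
s^{δ-2}. -/
theorem abs_exp_mul_second_deriv_le {κ b s T δ B p p1 p2 : ℝ} (hκ : |κ| ≤ b) (hs : s ∈ Ioo 0 T)
    (hδ : δ ∈ Ioo (0 : ℝ) 2) (hB : 0 ≤ B) (hp : |p| ≤ B) (hp1 : |p1| ≤ B * (1 + s ^ (δ - 1)))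
    (hp2 : |p2| ≤ B * (1 + s ^ (δ - 2))) :
    |Real.exp (κ * s) * (κ ^ 2 * p + 2 * κ * p1 + p2)|
      ≤ Real.exp (b * T) * B * (b ^ 2 * T ^ (2 - δ) + 2 * b * (T ^ (2 - δ) + T)
        + (T ^ (2 - δ) + 1)) * s ^ (δ - 2) := by
  have hs0 := hs.1
  have hb : 0 ≤ b := (abs_nonneg _).trans hκ
  have hT : 0 < T := hs.1.trans hs.2
  have a0 : 0 ≤ s ^ (δ - 2) := by positivity
  have a1 : 1 ≤ T ^ (2 - δ) * s ^ (δ - 2) := by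
    rw [show δ - 2 = -(2 - δ) by ring, Real.rpow_neg hs0.le, ← div_eq_mul_inv,
      one_le_div (by positivity)]
    exact Real.rpow_le_rpow hs0.le hs.2.le (by linarith [hδ.2])
  have a2 : s ^ (δ - 1) ≤ T * s ^ (δ - 2) := by
    rw [show δ - 1 = 1 + (δ - 2) by ring, Real.rpow_add hs0, Real.rpow_one]
    exact mul_le_mul_of_nonneg_right hs.2.le a0
  rw [abs_mul, abs_of_pos (Real.exp_pos _), mul_assoc (Real.exp (b * T)) B,
    mul_assoc (Real.exp (b * T))]
  refine mul_le_mul (exp_mul_le hκ (by rw [abs_of_pos hs0]; exact hs.2.le)) ?_ (abs_nonneg _)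
    (Real.exp_pos _).le
  calc |κ ^ 2 * p + 2 * κ * p1 + p2| ≤ |κ| ^ 2 * |p| + 2 * |κ| * |p1| + |p2| := by
        refine (abs_add_le _ _).trans (add_le_add_left ((abs_add_le _ _).trans ?_) _)
        simp [abs_mul]
    _ ≤ b ^ 2 * B + 2 * b * (B * (1 + s ^ (δ - 1))) + B * (1 + s ^ (δ - 2)) := by gcongr
    _ ≤ b ^ 2 * (B * (T ^ (2 - δ) * s ^ (δ - 2)))
        + 2 * b * (B * (T ^ (2 - δ) * s ^ (δ - 2) + T * s ^ (δ - 2)))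
        + B * (T ^ (2 - δ) * s ^ (δ - 2) + s ^ (δ - 2)) := by
      gcongr
      exact le_mul_of_one_le_right hB a1
    _ = _ := by ring

section

variable {Nx Ny k : ℕ} (m : RectMesh Nx Ny)

theorem hasDerivAt_iteratedDerivWithin {T : ℝ} {u : ℝ → DGSpace Nx Ny k}
    (hu : ContDiffOn ℝ 2 u (Ioc 0 T)) {s : ℝ} (hs : s ∈ Ioo 0 T) :
    HasDerivAt u (iteratedDerivWithin 1 u (Ioc 0 T) s) s ∧
      HasDerivAt (iteratedDerivWithin 1 u (Ioc 0 T)) (iteratedDerivWithin 2 u (Ioc 0 T) s) s := by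
  have hn : Ioc 0 T ∈ nhds s := Ioc_mem_nhds hs.1 hs.2
  have hs' : s ∈ Ioc 0 T := Ioo_subset_Ioc_self hs
  constructor
  · rw [iteratedDerivWithin_one]
    exact (hu.differentiableOn (by norm_num) s hs').hasDerivWithinAt.hasDerivAt hn
  · rw [iteratedDerivWithin_succ (n := 1)]
    exact (hu.differentiableOn_iteratedDerivWithin (m := 1) (by norm_num)
      (uniqueDiffOn_Ioc 0 T) s hs').hasDerivWithinAt.hasDerivAt hn

/-- Regularity of `s ↦ e^{κ s} u(s)` at the points of space, uniformly in space. -/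
theorem exists_second_deriv_bound {T δ b : ℝ} (hδ : δ ∈ Ioo (0 : ℝ) 2)
    {κ : ℝ × ℝ → ℝ} (hκ : ∀ z ∈ m.domain, |κ z| ≤ b) {u : ℝ → DGSpace Nx Ny k}
    (huc : ContinuousOn u (Icc 0 T)) (hu : MemC2Delta m δ T u) :
    ∃ K : ℝ, 0 ≤ K ∧ ∀ i j, ∀ z ∈ m.domain,
      ContinuousOn (fun s => Real.exp (κ z * s) * (u s i j).eval z) (Icc 0 T) ∧
      ∃ F1 F2 : ℝ → ℝ,
        (∀ s ∈ Ioo 0 T, HasDerivAt (fun s => Real.exp (κ z * s) * (u s i j).eval z) (F1 s) s) ∧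
        (∀ s ∈ Ioo 0 T, HasDerivAt F1 (F2 s) s) ∧
        ∀ s ∈ Ioo 0 T, |F2 s| ≤ K * s ^ (δ - 2) := by
  obtain ⟨hu2, Cu, hCu⟩ := hu
  obtain ⟨C, hC, hCe⟩ := exists_abs_eval_le (k := k) m
  obtain ⟨R, hR⟩ := isCompact_Icc.bddAbove_image ((continuous_dgNorm m).comp_continuousOn huc)
  set B := C * (|Cu| + |R|)
  have hB : 0 ≤ B := by positivity
  have hB1 : C * |Cu| ≤ B := mul_le_mul_of_nonneg_left (le_add_of_nonneg_right (abs_nonneg R)) hC.le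
  have hder : ∀ l, (l = 1 ∨ l = 2) → ∀ s ∈ Ioo 0 T, ∀ i j, ∀ z ∈ m.domain,
      |(iteratedDerivWithin l u (Ioc 0 T) s i j).eval z| ≤ B * (1 + s ^ (δ - (l : ℝ))) := by
    intro l hl s hs i j z hz
    have h0 : 0 ≤ 1 + s ^ (δ - (l : ℝ)) := add_nonneg zero_le_one (Real.rpow_nonneg hs.1.le _)
    calc _ ≤ C * dgNorm m (iteratedDerivWithin l u (Ioc 0 T) s) := hCe _ i j z hz
      _ ≤ C * (|Cu| * (1 + s ^ (δ - (l : ℝ)))) := by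
        refine mul_le_mul_of_nonneg_left ?_ hC.le
        exact (hCu l hl s (Ioo_subset_Ioc_self hs)).trans
          (mul_le_mul_of_nonneg_right (le_abs_self Cu) h0)
      _ = C * |Cu| * (1 + s ^ (δ - (l : ℝ))) := by ring
      _ ≤ _ := mul_le_mul_of_nonneg_right hB1 h0
  refine ⟨Real.exp (|b| * T) * B * (|b| ^ 2 * |T| ^ (2 - δ) + 2 * |b| * (|T| ^ (2 - δ) + |T|)
        + (|T| ^ (2 - δ) + 1)), by positivity, fun i j z hz => ⟨?_, ?_⟩⟩
  · refine ContinuousOn.mul (by fun_prop) ?_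
    exact (evalCLM i j z).continuous.comp_continuousOn huc
  · have d1 : ∀ s ∈ Ioo 0 T, HasDerivAt (fun s => (u s i j).eval z)
        ((iteratedDerivWithin 1 u (Ioc 0 T) s i j).eval z) s := fun s hs =>
      (evalCLM i j z).hasFDerivAt.comp_hasDerivAt s (hasDerivAt_iteratedDerivWithin hu2 hs).1
    have d2 : ∀ s ∈ Ioo 0 T, HasDerivAt
        (fun s => (iteratedDerivWithin 1 u (Ioc 0 T) s i j).eval z)
        ((iteratedDerivWithin 2 u (Ioc 0 T) s i j).eval z) s := fun s hs =>
      (evalCLM i j z).hasFDerivAt.comp_hasDerivAt s (hasDerivAt_iteratedDerivWithin hu2 hs).2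
    refine ⟨_, fun s => Real.exp (κ z * s) * (κ z ^ 2 * (u s i j).eval z
      + 2 * κ z * (iteratedDerivWithin 1 u (Ioc 0 T) s i j).eval z
      + (iteratedDerivWithin 2 u (Ioc 0 T) s i j).eval z), fun s hs => hasDerivAt_exp_mul
        (φ1 := fun s => (iteratedDerivWithin 1 u (Ioc 0 T) s i j).eval z) (d1 s hs),
      fun s hs => hasDerivAt_exp_mul_deriv
        (φ2 := fun s => (iteratedDerivWithin 2 u (Ioc 0 T) s i j).eval z) (d1 s hs) (d2 s hs), fun s hs => ?_⟩
    have hT : |T| = T := abs_of_pos (hs.1.trans hs.2)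
    rw [hT]
    refine abs_exp_mul_second_deriv_le ((hκ z hz).trans (le_abs_self b)) hs hδ hB ?_ ?_ ?_
    · refine (hCe _ i j z hz).trans (mul_le_mul_of_nonneg_left ?_ hC.le)
      have : dgNorm m (u s) ≤ R := hR ⟨s, Ioo_subset_Icc_self hs, rfl⟩
      linarith [le_abs_self R, abs_nonneg Cu]
    · simpa using hder 1 (Or.inl rfl) s hs i j z hz
    · simpa using hder 2 (Or.inr rfl) s hs i j z hz

theorem exists_truncation_bound_subst {T γ δ α b : ℝ} (hT : 0 < T) (hγ : 1 ≤ γ)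
    (hα : α ∈ Ioo (0 : ℝ) 1) (hδ : δ ∈ Ioo (0 : ℝ) 2) (hδ1 : δ ≠ 1)
    {κ : ℝ × ℝ → ℝ} (hκ : ∀ z ∈ m.domain, |κ z| ≤ b) {u : ℝ → DGSpace Nx Ny k}
    (huc : ContinuousOn u (Icc 0 T)) (hu : MemC2Delta m δ T u) :
    ∃ C : ℝ, 0 ≤ C ∧ ∀ M n : ℕ, 1 ≤ M → 1 ≤ n → n ≤ M → ∀ i j, ∀ z ∈ m.domain,
      |caputoSubst α (κ z) (fun s => (u s i j).eval z) (gradedTime T γ M n)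
          - l1Subst α (κ z) (gradedTime T γ M) n (fun l => (u (gradedTime T γ M l) i j).eval z)|
        ≤ C * gradedTime T γ M n ^ (-α) * (M : ℝ) ^ (-min (2 - α) (γ * δ)) := by
  obtain ⟨K, hK, hF⟩ := exists_second_deriv_bound m hδ hκ huc hu
  obtain ⟨C, hC, htr⟩ := exists_truncation_bound hT hγ hα hδ hδ1
  refine ⟨Real.exp (|b| * T) * (C * K), by positivity, fun M n hM hn hnM i j z hz => ?_⟩
  obtain ⟨hc, F1, F2, h1, h2, h3⟩ := hF i j z hz
  have htn := gradedTime_pos (γ := γ) hT hM hn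
  have htT : gradedTime T γ M n ≤ T := gradedTime_le hT hγ hM hnM
  have hsub : Ioo 0 (gradedTime T γ M n) ⊆ Ioo 0 T := Ioo_subset_Ioo_right htT
  have key := htr K _ F1 F2 M n hK hM hn hnM (hc.mono (Icc_subset_Icc_right htT))
    (fun s hs => h1 s (hsub hs)) (fun s hs => h2 s (hsub hs)) (fun s hs => h3 s (hsub hs))
  rw [l1Subst_eq α (κ z) (gradedTime_zero hγ M) hn, caputoSubst, ← mul_sub, abs_mul,
    abs_of_pos (Real.exp_pos _)]
  calc _ ≤ Real.exp (|b| * T) * (C * K * gradedTime T γ M n ^ (-α)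
        * (M : ℝ) ^ (-min (2 - α) (γ * δ))) := by
        refine mul_le_mul (exp_mul_le ?_ ?_) key (abs_nonneg _) (Real.exp_pos _).le
        · rw [abs_neg]; exact (hκ z hz).trans (le_abs_self b)
        · rwa [abs_of_pos htn]
    _ = _ := by ring

/-! ### Integrability on cells -/

theorem measurable_l1Subst {κ : ℝ × ℝ → ℝ} (hκ : Measurable κ) (α : ℝ) (t : ℕ → ℝ) (n : ℕ)
    (v : ℕ → LocalQ k) : Measurable fun z => l1Subst α (κ z) t n fun l => (v l).eval z := by
  have hv : ∀ l, Measurable (v l).eval := fun l => (v l).continuous_eval.measurable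
  unfold l1Subst
  fun_prop

theorem integrableOn_mul_of_continuous {f g : ℝ × ℝ → ℝ} {i : Fin Nx} {j : Fin Ny}
    (hf : IntegrableOn f (m.cell i j)) (hg : Continuous g) :
    IntegrableOn (fun z => f z * g z) (m.cell i j) := by
  obtain ⟨R, hR⟩ := (isCompact_Icc.prod isCompact_Icc :
    IsCompact (Icc (m.xl i) (m.xr i) ×ˢ Icc (m.yl j) (m.yr j))).exists_bound_of_continuousOn
      hg.continuousOn
  refine Integrable.mul_bdd (c := R) hf hg.aestronglyMeasurable ?_
  refine (ae_restrict_mem (m.measurableSet_cell i j)).mono fun z hz => ?_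
  exact hR z (prod_mono Ioo_subset_Icc_self Ioo_subset_Icc_self hz)

theorem integrableOn_exp_mul {κ : ℝ × ℝ → ℝ} {b : ℝ} (hκm : Measurable κ)
    (hκ : ∀ z ∈ m.domain, |κ z| ≤ b) (r : ℝ) (i : Fin Nx) (j : Fin Ny) :
    IntegrableOn (fun z => Real.exp (-κ z * r)) (m.cell i j) := by
  refine Measure.integrableOn_of_bounded (M := Real.exp (b * |r|)) (m.volume_cell_ne_top i j)
    (by fun_prop) ?_
  refine (ae_restrict_mem (m.measurableSet_cell i j)).mono fun z hz => ?_
  rw [Real.norm_eq_abs, abs_of_pos (Real.exp_pos _)]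
  exact exp_mul_le (by rw [abs_neg]; exact hκ z (m.cell_subset_domain i j hz)) le_rfl

theorem integrableOn_l1Subst {κ : ℝ × ℝ → ℝ} {b : ℝ} (hκm : Measurable κ)
    (hκ : ∀ z ∈ m.domain, |κ z| ≤ b) (α : ℝ) (t : ℕ → ℝ) (n : ℕ) (v : ℕ → LocalQ k)
    (i : Fin Nx) (j : Fin Ny) :
    IntegrableOn (fun z => l1Subst α (κ z) t n fun l => (v l).eval z) (m.cell i j) := by
  have he : ∀ (c r : ℝ) (l : ℕ),
      IntegrableOn (fun z => c * Real.exp (-κ z * r) * (v l).eval z) (m.cell i j) := fun c r l =>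
    integrableOn_mul_of_continuous m ((integrableOn_exp_mul m hκm hκ r i j).const_mul c)
      (v l).continuous_eval
  unfold l1Subst
  refine Integrable.add (Integrable.sub ?_ (he _ _ 0)) (integrable_finsetSum _ fun l _ => he _ _ _)
  exact (m.integrableOn_cell (v n).continuous_eval i j).const_mul _

theorem gradedTime_mul_mul (T γ : ℝ) {q : ℕ} (hq : q ≠ 0) (M n : ℕ) :
    gradedTime T γ (q * M) (q * n) = gradedTime T γ M n := by
  unfold gradedTime
  push_cast
  rw [mul_div_mul_left _ _ (Nat.cast_ne_zero.2 hq)]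

/-- The substantial derivative is the limit of its L1 approximations on refined meshes, hence
measurable in space. -/
theorem integrableOn_caputoSubst {T γ δ α b : ℝ} (hT : 0 < T) (hγ : 1 ≤ γ)
    (hα : α ∈ Ioo (0 : ℝ) 1) (hδ : δ ∈ Ioo (0 : ℝ) 2) (hδ1 : δ ≠ 1)
    {κ : ℝ × ℝ → ℝ} (hκm : Measurable κ) (hκ : ∀ z ∈ m.domain, |κ z| ≤ b)
    {u : ℝ → DGSpace Nx Ny k} (huc : ContinuousOn u (Icc 0 T)) (hu : MemC2Delta m δ T u)
    {M n : ℕ} (hM : 1 ≤ M) (hn : 1 ≤ n) (hnM : n ≤ M) (i : Fin Nx) (j : Fin Ny) :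
    IntegrableOn (fun z => caputoSubst α (κ z) (fun s => (u s i j).eval z) (gradedTime T γ M n))
      (m.cell i j) := by
  obtain ⟨C, hC, h⟩ := exists_truncation_bound_subst m hT hγ hα hδ hδ1 hκ huc hu
  have hμ : 0 < min (2 - α) (γ * δ) :=
    lt_min (by linarith [hα.2]) (mul_pos (by linarith) hδ.1)
  set D : ℝ × ℝ → ℝ := fun z =>
    caputoSubst α (κ z) (fun s => (u s i j).eval z) (gradedTime T γ M n)
  have hmeas : AEStronglyMeasurable D (volume.restrict (m.cell i j)) := by
    -- The mesh with (q+1)M steps has the fixed time t_n as its node (q+1)n, and there the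
    -- truncation bound tends to 0 as q grows.
    refine aestronglyMeasurable_of_tendsto_ae Filter.atTop
      (f := fun (q : ℕ) z => l1Subst α (κ z) (gradedTime T γ ((q + 1) * M)) ((q + 1) * n)
        (fun l => (u (gradedTime T γ ((q + 1) * M) l) i j).eval z))
      (fun q => (measurable_l1Subst hκm _ _ _ _).aestronglyMeasurable) ?_
    refine (ae_restrict_mem (m.measurableSet_cell i j)).mono fun z hz => ?_
    have hlim : Filter.Tendsto (fun q : ℕ => C * gradedTime T γ M n ^ (-α)
        * (((q + 1) * M : ℕ) : ℝ) ^ (-min (2 - α) (γ * δ))) Filter.atTop (nhds 0) := by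
      rw [← mul_zero (C * gradedTime T γ M n ^ (-α))]
      refine Filter.Tendsto.const_mul _ ((tendsto_rpow_neg_atTop hμ).comp
        (tendsto_natCast_atTop_atTop.comp ?_))
      exact Filter.tendsto_atTop_mono (fun q => (Nat.le_succ q).trans
        (Nat.le_mul_of_pos_right _ hM)) Filter.tendsto_id
    rw [tendsto_iff_dist_tendsto_zero]
    refine squeeze_zero (fun _ => dist_nonneg) (fun q => ?_) hlim
    have := h ((q + 1) * M) ((q + 1) * n) (Nat.mul_pos q.succ_pos hM) (Nat.mul_pos q.succ_pos hn)
      (Nat.mul_le_mul_left _ hnM) i j z (m.cell_subset_domain i j hz)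
    rw [gradedTime_mul_mul T γ (Nat.succ_ne_zero q)] at this
    rw [dist_comm, Real.dist_eq]
    exact this
  have hl := integrableOn_l1Subst m hκm hκ α (gradedTime T γ M) n
    (fun l => u (gradedTime T γ M l) i j) i j
  have hR : IntegrableOn (fun z => D z - l1Subst α (κ z) (gradedTime T γ M) n
      fun l => (u (gradedTime T γ M l) i j).eval z) (m.cell i j) := by
    have : IsFiniteMeasure (volume.restrict (m.cell i j)) :=
      isFiniteMeasure_restrict.2 (m.volume_cell_ne_top i j)
    refine Integrable.of_bound (hmeas.sub hl.aestronglyMeasurable)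
      (C * gradedTime T γ M n ^ (-α) * (M : ℝ) ^ (-min (2 - α) (γ * δ))) ?_
    refine (ae_restrict_mem (m.measurableSet_cell i j)).mono fun z hz => ?_
    exact h M n hM hn hnM i j z (m.cell_subset_domain i j hz)
  refine (hR.add hl).congr (ae_of_all _ fun z => ?_)
  simp [D]

end

/-! ### Stability of the L1 scheme -/

theorem l1Subst_sub (α κ : ℝ) (t : ℕ → ℝ) (n : ℕ) (f g : ℕ → ℝ) :
    l1Subst α κ t n f - l1Subst α κ t n g = l1Subst α κ t n (fun l => f l - g l) := by
  unfold l1Subst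
  have : ∑ i ∈ Finset.Ico 1 n, (l1Coeff α t n i - l1Coeff α t n (i - 1))
        * Real.exp (-κ * (t n - t (n - i))) * (f (n - i) - g (n - i))
      = ∑ i ∈ Finset.Ico 1 n, (l1Coeff α t n i - l1Coeff α t n (i - 1))
          * Real.exp (-κ * (t n - t (n - i))) * f (n - i)
        - ∑ i ∈ Finset.Ico 1 n, (l1Coeff α t n i - l1Coeff α t n (i - 1))
          * Real.exp (-κ * (t n - t (n - i))) * g (n - i) := by
    rw [← Finset.sum_sub_distrib]
    exact Finset.sum_congr rfl fun i _ => by ring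
  rw [this]
  ring

theorem sum_sub_eq_sub (A : ℕ → ℝ) {n : ℕ} (hn : 1 ≤ n) :
    ∑ i ∈ Finset.Ico 1 n, (A (i - 1) - A i) = A 0 - A (n - 1) := by
  have h := sum_increments_eq A (fun _ => 1) hn
  simp only [sub_self, mul_zero, Finset.sum_const_zero, mul_one] at h
  have e : ∑ i ∈ Finset.Ico 1 n, (A (i - 1) - A i)
      = -∑ i ∈ Finset.Ico 1 n, (A i - A (i - 1)) := by
    rw [← Finset.sum_neg_distrib]; exact Finset.sum_congr rfl fun i _ => by ring
  rw [e]; linarith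

theorem l1Coeff_last_pos {α : ℝ} (hα : α ∈ Ioo (0 : ℝ) 1) {t : ℕ → ℝ} (ht : StrictMono t)
    (ht0 : t 0 = 0) {n : ℕ} (hn : 1 ≤ n) : 0 < l1Coeff α t n (n - 1) := by
  refine lt_of_lt_of_le ?_ (rpow_div_Gamma_le_l1Coeff hα ht ht0 hn)
  have h1 : 0 < t n := ht0 ▸ ht (by omega)
  have h2 : 0 < Real.Gamma (1 - α) := Real.Gamma_pos_of_pos (by linarith [hα.2])
  positivity

theorem l1Coeff_last_le {α : ℝ} (hα : α ∈ Ioo (0 : ℝ) 1) {t : ℕ → ℝ} (ht : StrictMono t)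
    {n : ℕ} (hn : 1 ≤ n) : l1Coeff α t n (n - 1) ≤ l1Coeff α t n 0 := by
  rw [← sub_nonneg, ← sum_sub_eq_sub _ hn]
  refine Finset.sum_nonneg fun i hi => ?_
  rw [Finset.mem_Ico] at hi
  exact sub_nonneg.2 (l1Coeff_le hα ht hi.1 hi.2)

/-- Discrete fractional Gronwall inequality. -/
theorem le_of_l1_inequality {α Q : ℝ} (hα : α ∈ Ioo (0 : ℝ) 1) {t : ℕ → ℝ} (ht : StrictMono t)
    (ht0 : t 0 = 0) {M : ℕ} {X : ℕ → ℝ} (hX0 : X 0 ≤ Q)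
    (h : ∀ n, 1 ≤ n → n ≤ M → l1Coeff α t n 0 * X n
      ≤ ∑ i ∈ Finset.Ico 1 n, (l1Coeff α t n (i - 1) - l1Coeff α t n i) * X (n - i)
        + l1Coeff α t n (n - 1) * Q) {n : ℕ} (hnM : n ≤ M) : X n ≤ Q := by
  induction n using Nat.strong_induction_on with
  | _ n ih =>
    rcases Nat.eq_zero_or_pos n with rfl | hn
    · exact hX0
    have hA0 : 0 < l1Coeff α t n 0 :=
      (l1Coeff_last_pos hα ht ht0 hn).trans_le (l1Coeff_last_le hα ht hn)
    -- The weights A_{i-1} - A_i and A_{n-1} are nonnegative and add up to A_0, so A_0 Q dominates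
    -- the right-hand side.
    refine le_of_mul_le_mul_left ((h n hn hnM).trans ?_) hA0
    have : ∑ i ∈ Finset.Ico 1 n, (l1Coeff α t n (i - 1) - l1Coeff α t n i) * X (n - i)
        ≤ ∑ i ∈ Finset.Ico 1 n, (l1Coeff α t n (i - 1) - l1Coeff α t n i) * Q := by
      refine Finset.sum_le_sum fun i hi => ?_
      rw [Finset.mem_Ico] at hi
      exact mul_le_mul_of_nonneg_left (ih _ (by omega) (by omega))
        (sub_nonneg.2 (l1Coeff_le hα ht hi.1 hi.2))
    rw [← Finset.sum_mul, sum_sub_eq_sub _ hn] at this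
    linarith

/-- Each history term is split by 2xy ≤ x² + y². The present then loses half of Σ(A_{i-1} - A_i) =
A_0 - A_{n-1}, which leaves (A_0 + A_{n-1})/2. The surplus A_{n-1}/2 exists because the initial term
vanishes. -/
theorem l1Subst_mul_self_ge {α κ b : ℝ} (hα : α ∈ Ioo (0 : ℝ) 1) (hκ : |κ| ≤ b) {t : ℕ → ℝ}
    (ht : StrictMono t) {n : ℕ} (hn : 1 ≤ n) {e : ℕ → ℝ} (he : e 0 = 0) :
    (l1Coeff α t n 0 + l1Coeff α t n (n - 1)) / 2 * (Real.exp (-b * t n) * e n) ^ 2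
        - 1 / 2 * ∑ i ∈ Finset.Ico 1 n, (l1Coeff α t n (i - 1) - l1Coeff α t n i)
          * (Real.exp (-b * t (n - i)) * e (n - i)) ^ 2
      ≤ Real.exp (-b * t n) ^ 2 * (l1Subst α κ t n e * e n) := by
  set w : ℕ → ℝ := fun l => Real.exp (-b * t l)
  have hw : ∀ l, 0 < w l := fun l => Real.exp_pos _
  have hterm : ∀ i ∈ Finset.Ico 1 n,
      -((l1Coeff α t n (i - 1) - l1Coeff α t n i) * (w (n - i) * e (n - i)) ^ 2
        + (l1Coeff α t n (i - 1) - l1Coeff α t n i) * (w n * e n) ^ 2) / 2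
      ≤ w n ^ 2 * ((l1Coeff α t n i - l1Coeff α t n (i - 1))
          * Real.exp (-κ * (t n - t (n - i))) * e (n - i) * e n) := by
    intro i hi
    rw [Finset.mem_Ico] at hi
    have hA : 0 ≤ l1Coeff α t n (i - 1) - l1Coeff α t n i :=
      sub_nonneg.2 (l1Coeff_le hα ht hi.1 hi.2)
    have hti : 0 < t n - t (n - i) := sub_pos.2 (ht (by omega))
    set E := Real.exp (-κ * (t n - t (n - i))) with hE
    -- The weight absorbs the exponential factor of the formula, since -κ ≤ b.
    have h1 : w n * E ≤ w (n - i) := by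
      simp only [w, hE]
      rw [← Real.exp_add, Real.exp_le_exp]
      have : -κ * (t n - t (n - i)) ≤ b * (t n - t (n - i)) :=
        mul_le_mul_of_nonneg_right ((neg_le_abs κ).trans hκ) hti.le
      linarith
    have h2 : (w n * e n) * (w n * E * e (n - i))
        ≤ ((w (n - i) * e (n - i)) ^ 2 + (w n * e n) ^ 2) / 2 := by
      have h3 : (w n * E * e (n - i)) ^ 2 ≤ (w (n - i) * e (n - i)) ^ 2 := by
        rw [mul_pow, mul_pow (w (n - i))]
        have : 0 ≤ w n * E := mul_nonneg (hw n).le (Real.exp_pos _).le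
        gcongr
      nlinarith [sq_nonneg (w n * e n - w n * E * e (n - i))]
    have := mul_le_mul_of_nonneg_left h2 hA
    linarith
  have hsum := Finset.sum_le_sum hterm
  have e1 : l1Subst α κ t n e * e n = l1Coeff α t n 0 * e n ^ 2
      + ∑ i ∈ Finset.Ico 1 n, (l1Coeff α t n i - l1Coeff α t n (i - 1))
          * Real.exp (-κ * (t n - t (n - i))) * e (n - i) * e n := by
    unfold l1Subst
    rw [he, mul_zero, sub_zero, add_mul, Finset.sum_mul]
    ring
  rw [← Finset.mul_sum, ← Finset.sum_div, Finset.sum_neg_distrib, Finset.sum_add_distrib,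
    ← Finset.sum_mul (Finset.Ico 1 n) _ ((w n * e n) ^ 2), sum_sub_eq_sub _ hn] at hsum
  change _ ≤ w n ^ 2 * _
  rw [e1]
  change _ * (w n * e n) ^ 2 - 1 / 2 * ∑ i ∈ Finset.Ico 1 n,
    (l1Coeff α t n (i - 1) - l1Coeff α t n i) * (w (n - i) * e (n - i)) ^ 2 ≤ _
  have : (w n * e n) ^ 2 = w n ^ 2 * e n ^ 2 := mul_pow _ _ _
  nlinarith

/-! ### The discrete energy estimate -/

section

variable {Nx Ny k : ℕ} (m : RectMesh Nx Ny)

/-- Young's inequality |ra| ≤ (A/2)a² + (A/2)ρ²: the first term uses up the surplus A/2 of the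
coercivity bound `hL`. The smallness of r is therefore measured relative to the last coefficient A.
-/
theorem pointwise_energy_le {A₀ A r ρ w S D D' L a : ℝ} (hA : 0 < A) (hw1 : w ^ 2 ≤ 1)
    (hD : D - D' = r + L) (hr : |r| ≤ ρ * A)
    (hL : (A₀ + A) / 2 * (w * a) ^ 2 - 1 / 2 * S ≤ w ^ 2 * (L * a)) :
    A₀ / 2 * (w ^ 2 * (a * a)) - 1 / 2 * S - A / 2 * ρ ^ 2 ≤ w ^ 2 * (D * a - D' * a) := by
  have h1 : D * a - D' * a = r * a + L * a := by rw [← sub_mul, hD, add_mul]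
  have h2 : r ^ 2 ≤ (ρ * A) ^ 2 := sq_le_sq' (neg_le_of_abs_le hr) (le_of_abs_le hr)
  have h3 : -(A / 2 * a ^ 2 + A / 2 * ρ ^ 2) ≤ r * a := by
    have h4 : 0 ≤ (r + A * a) ^ 2 := sq_nonneg _
    have h5 : 0 ≤ A * (A * a ^ 2 + A * ρ ^ 2 + 2 * (r * a)) := by nlinarith
    have := nonneg_of_mul_nonneg_right h5 hA
    linarith
  have h6 := mul_le_mul_of_nonneg_left h3 (sq_nonneg w)
  have h7 : w ^ 2 * (A / 2 * ρ ^ 2) ≤ A / 2 * ρ ^ 2 :=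
    mul_le_of_le_one_left (by positivity) hw1
  rw [h1]
  nlinarith

/-- The potential depends on z, so the quadratic estimate is made pointwise. Its remaining
coefficients are constant in space, and integration turns squares into norms. -/
theorem integral_energy_le {A₀ ρ W c : ℝ} {n : ℕ} {a w : ℕ → ℝ} {v : ℕ → LocalQ k}
    {D D' : ℝ × ℝ → ℝ} {i : Fin Nx} {j : Fin Ny} (hD : IntegrableOn D (m.cell i j))
    (hD' : IntegrableOn D' (m.cell i j))
    (h : ∀ z ∈ m.cell i j, A₀ * (W * ((v n).eval z * (v n).eval z))
        - c * ∑ l ∈ Finset.Ico 1 n, a l * (w l * ((v (n - l)).eval z * (v (n - l)).eval z)) - ρ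
      ≤ W * (D z * (v n).eval z - D' z * (v n).eval z)) :
    A₀ * (W * m.cellInner i j (v n).eval (v n).eval)
        - c * ∑ l ∈ Finset.Ico 1 n, a l * (w l * m.cellInner i j (v (n - l)).eval (v (n - l)).eval)
        - ρ * volume.real (m.cell i j)
      ≤ W * (m.cellInner i j D (v n).eval - m.cellInner i j D' (v n).eval) := by
  have hv : ∀ l, IntegrableOn (fun z => (v l).eval z * (v l).eval z) (m.cell i j) := fun l =>
    m.integrableOn_cell ((v l).continuous_eval.mul (v l).continuous_eval) i j
  have hDv := integrableOn_mul_of_continuous m hD (v n).continuous_eval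
  have hDv' := integrableOn_mul_of_continuous m hD' (v n).continuous_eval
  have i1 : IntegrableOn (fun z => A₀ * (W * ((v n).eval z * (v n).eval z))) (m.cell i j) :=
    ((hv n).const_mul _).const_mul _
  have i2' : ∀ l ∈ Finset.Ico 1 n, IntegrableOn
      (fun z => a l * (w l * ((v (n - l)).eval z * (v (n - l)).eval z))) (m.cell i j) :=
    fun l _ => ((hv _).const_mul _).const_mul _
  have i2 : IntegrableOn (fun z => c * ∑ l ∈ Finset.Ico 1 n,
      a l * (w l * ((v (n - l)).eval z * (v (n - l)).eval z))) (m.cell i j) :=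
    (integrable_finsetSum _ i2').const_mul c
  have i12 : IntegrableOn (fun z => A₀ * (W * ((v n).eval z * (v n).eval z)) - c *
      ∑ l ∈ Finset.Ico 1 n, a l * (w l * ((v (n - l)).eval z * (v (n - l)).eval z)))
        (m.cell i j) := i1.sub i2
  have i3 : IntegrableOn (fun _ : ℝ × ℝ => ρ) (m.cell i j) :=
    integrableOn_const (m.volume_cell_ne_top i j)
  have key := setIntegral_mono_on (i12.sub i3) ((hDv.sub hDv').const_mul W)
    (m.measurableSet_cell i j) h
  have e1 : ∫ z in m.cell i j, W * (D z * (v n).eval z - D' z * (v n).eval z)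
      = W * (m.cellInner i j D (v n).eval - m.cellInner i j D' (v n).eval) := by
    rw [integral_const_mul, integral_sub hDv hDv']; rfl
  have e2 : ∫ z in m.cell i j, (A₀ * (W * ((v n).eval z * (v n).eval z))
        - c * ∑ l ∈ Finset.Ico 1 n, a l * (w l * ((v (n - l)).eval z * (v (n - l)).eval z)) - ρ)
      = A₀ * (W * m.cellInner i j (v n).eval (v n).eval)
        - c * ∑ l ∈ Finset.Ico 1 n, a l * (w l * m.cellInner i j (v (n - l)).eval (v (n - l)).eval)
        - ρ * volume.real (m.cell i j) := by
    rw [integral_sub i12 i3, integral_sub i1 i2, integral_const_mul, integral_const_mul,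
      integral_const_mul, integral_finsetSum _ i2', setIntegral_const, smul_eq_mul, mul_comm _ ρ]
    simp_rw [integral_const_mul]
    rfl
  rw [← e1, ← e2]
  exact key

theorem sum_energy_eq (A₀ ρ W c : ℝ) (n : ℕ) (a w : ℕ → ℝ) (v : ℕ → DGSpace Nx Ny k) :
    ∑ i, ∑ j, (A₀ * (W * m.cellInner i j (v n i j).eval (v n i j).eval)
        - c * ∑ l ∈ Finset.Ico 1 n,
          a l * (w l * m.cellInner i j (v (n - l) i j).eval (v (n - l) i j).eval)
        - ρ * volume.real (m.cell i j))
      = A₀ * (W * dgNorm m (v n) ^ 2)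
        - c * ∑ l ∈ Finset.Ico 1 n, a l * (w l * dgNorm m (v (n - l)) ^ 2)
        - ρ * ∑ i, ∑ j, volume.real (m.cell i j) := by
  simp only [dgNorm_sq, Finset.mul_sum, Finset.sum_sub_distrib]
  congr 2
  exact (Finset.sum_congr rfl fun i _ => Finset.sum_comm).trans Finset.sum_comm

variable [NeZero Nx] [NeZero Ny]

/-- Stability: the fully discrete error is controlled by the truncation error. -/
theorem exp_mul_dgNorm_sub_le {σ₁ σ₂ T γ α b ρ : ℝ} (hT : 0 < T) (hγ : 1 ≤ γ)
    (hα : α ∈ Ioo (0 : ℝ) 1) {κ u₀ : ℝ × ℝ → ℝ} (hκm : Measurable κ)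
    (hκ : ∀ z ∈ m.domain, |κ z| ≤ b) (hb : 0 ≤ b) {u : ℝ → DGSpace Nx Ny k}
    {p : ℝ → DGSpace Nx Ny k × DGSpace Nx Ny k}
    (hup : IsSemiDiscreteSolution m σ₁ σ₂ α T κ u₀ u p) {M : ℕ} (hM : 1 ≤ M)
    (hint : ∀ n, 1 ≤ n → n ≤ M → ∀ i j, IntegrableOn (fun z =>
      caputoSubst α (κ z) (fun s => (u s i j).eval z) (gradedTime T γ M n)) (m.cell i j))
    (htr : ∀ n, 1 ≤ n → n ≤ M → ∀ i j, ∀ z ∈ m.domain,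
      |caputoSubst α (κ z) (fun s => (u s i j).eval z) (gradedTime T γ M n)
          - l1Subst α (κ z) (gradedTime T γ M) n (fun l => (u (gradedTime T γ M l) i j).eval z)|
        ≤ ρ * l1Coeff α (gradedTime T γ M) n (n - 1))
    {U : ℕ → DGSpace Nx Ny k} {P : ℕ → DGSpace Nx Ny k × DGSpace Nx Ny k}
    (hUP : IsFullyDiscreteSolution m σ₁ σ₂ α T γ M κ u₀ U P) {n : ℕ} (hn : n ≤ M) :
    Real.exp (-b * gradedTime T γ M n) ^ 2 * dgNorm m (u (gradedTime T γ M n) - U n) ^ 2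
      ≤ ρ ^ 2 * ∑ i, ∑ j, volume.real (m.cell i j) := by
  set t := gradedTime T γ M with ht
  have hmono : StrictMono t := gradedTime_strictMono hT hγ hM
  have ht0 : t 0 = 0 := gradedTime_zero hγ M
  set e : ℕ → DGSpace Nx Ny k := fun l => u (t l) - U l with he
  have he0 : e 0 = 0 := by
    simp only [he, ht0]
    rw [eq_of_schemeInit m hup.init hUP.init, sub_self]
  have hV : 0 ≤ ∑ i, ∑ j, volume.real (m.cell i j) :=
    Finset.sum_nonneg fun i _ => Finset.sum_nonneg fun j _ => measureReal_nonneg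
  set w : ℕ → ℝ := fun l => Real.exp (-b * t l) with hw
  refine le_of_l1_inequality hα hmono ht0 (M := M) (X := fun l => w l ^ 2 * dgNorm m (e l) ^ 2)
    ?_ ?_ hn
  · simp only [he0, dgNorm_sq]
    have : ∀ i j, m.cellInner i j ((0 : DGSpace Nx Ny k) i j).eval
        ((0 : DGSpace Nx Ny k) i j).eval = 0 := fun i j => by
      simp [RectMesh.cellInner, LocalQ.eval]
    simp only [this, Finset.sum_const_zero, mul_zero]
    positivity
  intro n hn1 hnM
  have htn : t n ∈ Ioc 0 T := ⟨gradedTime_pos hT hM hn1, gradedTime_le hT hγ hM hnM⟩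
  have hA : 0 < l1Coeff α t n (n - 1) := l1Coeff_last_pos hα hmono ht0 hn1
  -- The truncation term is thus not enlarged by the weight; this is where b ≥ 0 enters.
  have hw1 : w n ^ 2 ≤ 1 := by
    refine pow_le_one₀ (Real.exp_pos _).le (Real.exp_le_one_iff.2 ?_)
    nlinarith [htn.1]
  have hpt : ∀ i j, ∀ z ∈ m.cell i j,
      l1Coeff α t n 0 / 2 * (w n ^ 2 * ((e n i j).eval z * (e n i j).eval z))
        - 1 / 2 * ∑ l ∈ Finset.Ico 1 n, (l1Coeff α t n (l - 1) - l1Coeff α t n l)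
          * (w (n - l) ^ 2 * ((e (n - l) i j).eval z * (e (n - l) i j).eval z))
        - l1Coeff α t n (n - 1) / 2 * ρ ^ 2
      ≤ w n ^ 2 * (caputoSubst α (κ z) (fun s => (u s i j).eval z) (t n) * (e n i j).eval z
          - l1Subst α (κ z) t n (fun l => (U l i j).eval z) * (e n i j).eval z) := by
    intro i j z hz
    have hz' := m.cell_subset_domain i j hz
    have hst := l1Subst_mul_self_ge hα (hκ z hz') hmono hn1
      (e := fun l => (u (t l) i j).eval z - (U l i j).eval z) (by
        have h0 : (e 0 i j).eval z = 0 := by rw [he0]; simp [LocalQ.eval]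
        rw [← h0]; exact (LocalQ.eval_sub _ _ z).symm)
    have hev : ∀ l, (e l i j).eval z = (u (t l) i j).eval z - (U l i j).eval z := fun l =>
      LocalQ.eval_sub _ _ z
    simp only [hev]
    have hS : ∀ l, w (n - l) ^ 2 * (((u (t (n - l)) i j).eval z - (U (n - l) i j).eval z)
          * ((u (t (n - l)) i j).eval z - (U (n - l) i j).eval z))
        = (w (n - l) * ((u (t (n - l)) i j).eval z - (U (n - l) i j).eval z)) ^ 2 := fun l => by
      ring
    simp only [hS]
    refine pointwise_energy_le hA hw1 ?_ (htr n hn1 hnM i j z hz') hst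
    rw [← l1Subst_sub]; ring
  have hcell := fun i j => integral_energy_le m (n := n)
    (a := fun l => l1Coeff α t n (l - 1) - l1Coeff α t n l) (w := fun l => w (n - l) ^ 2)
    (v := fun l => e l i j) (hint n hn1 hnM i j)
    (integrableOn_l1Subst m hκm hκ α t n (fun l => U l i j) i j) (hpt i j)
  have hsum := Finset.sum_le_sum fun i (_ : i ∈ Finset.univ) =>
    Finset.sum_le_sum fun j (_ : j ∈ Finset.univ) => hcell i j
  have henergy := sum_cellInner_sub_le_zero m (hup.eq1 (t n) htn) (hUP.eq1 n hn1 hnM)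
    (hup.eq2 (t n) htn) (hUP.eq2 n hn1 hnM)
  rw [sum_energy_eq m _ _ _ _ n _ _ e] at hsum
  simp only [← Finset.mul_sum] at hsum
  have := hsum.trans (mul_nonpos_of_nonneg_of_nonpos (sq_nonneg (w n)) henergy)
  linarith

end

end FeynmanKacLDG

end

/-! ### The convergence rate -/

theorem theorem4p2 {Nx Ny : ℕ} [NeZero Nx] [NeZero Ny] (k : ℕ)
    (m : FeynmanKacLDG.RectMesh Nx Ny) (σ₁ σ₂ : ℝ) (hσ₁ : σ₁ ≠ 1 / 2) (hσ₂ : σ₂ ≠ 1 / 2)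
    (α T γ δ : ℝ) (hα : α ∈ Set.Ioo (0 : ℝ) 1) (hT : 0 < T) (hγ : 1 ≤ γ)
    (hδ : δ ∈ Set.Ioo (0 : ℝ) 1 ∪ Set.Ioo (1 : ℝ) 2)
    (κ u₀ : ℝ × ℝ → ℝ) (hκ : Measurable κ) (hκb : ∃ Cκ : ℝ, ∀ z ∈ m.domain, |κ z| ≤ Cκ)
    (hu₀ : MeasureTheory.MemLp u₀ 2 (MeasureTheory.volume.restrict m.domain))
    (u : ℝ → FeynmanKacLDG.DGSpace Nx Ny k)
    (p : ℝ → FeynmanKacLDG.DGSpace Nx Ny k × FeynmanKacLDG.DGSpace Nx Ny k)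
    (hup : FeynmanKacLDG.IsSemiDiscreteSolution m σ₁ σ₂ α T κ u₀ u p)
    (hu : FeynmanKacLDG.MemC2Delta m δ T u) :
    ∃ C : ℝ, 0 < C ∧ ∀ M : ℕ, 1 ≤ M →
      ∀ (U : ℕ → FeynmanKacLDG.DGSpace Nx Ny k)
        (P : ℕ → FeynmanKacLDG.DGSpace Nx Ny k × FeynmanKacLDG.DGSpace Nx Ny k),
        FeynmanKacLDG.IsFullyDiscreteSolution m σ₁ σ₂ α T γ M κ u₀ U P →
          ∀ n : ℕ, 1 ≤ n → n ≤ M →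
            FeynmanKacLDG.dgNorm m (u (FeynmanKacLDG.gradedTime T γ M n) - U n)
              ≤ C * FeynmanKacLDG.maxStep T γ M ^ min (2 - α) (γ * δ) := by
  open FeynmanKacLDG in
  obtain ⟨Cκ, hCκ⟩ := hκb
  set b := |Cκ|
  have hb : ∀ z ∈ m.domain, |κ z| ≤ b := fun z hz => (hCκ z hz).trans (le_abs_self Cκ)
  have hδ2 : δ ∈ Set.Ioo (0 : ℝ) 2 := by
    rcases hδ with h | h
    · exact ⟨h.1, h.2.trans one_lt_two⟩
    · exact ⟨one_pos.trans h.1, h.2⟩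
  have hδ1 : δ ≠ 1 := by
    rcases hδ with h | h
    · exact h.2.ne
    · exact h.1.ne'
  obtain ⟨C, hC, htr⟩ :=
    exists_truncation_bound_subst m hT hγ hα hδ2 hδ1 hb hup.continuousOn hu
  set μ := min (2 - α) (γ * δ)
  have hμ : 0 < μ := lt_min (by linarith [hα.2]) (mul_pos (by linarith) hδ2.1)
  have hG : 0 < Real.Gamma (1 - α) := Real.Gamma_pos_of_pos (by linarith [hα.2])
  set V := ∑ i, ∑ j, MeasureTheory.volume.real (m.cell i j)
  have hV : 0 ≤ V :=
    Finset.sum_nonneg fun i _ => Finset.sum_nonneg fun j _ => MeasureTheory.measureReal_nonneg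
  -- The factors undo the weight e^{-b t_n}, bound the truncation error by the last coefficient,
  -- integrate over the domain and replace M^{-μ} by a power of the maximal step. The added 1 makes
  -- the constant positive, since C may be 0.
  refine ⟨Real.exp (b * T) * (C * Real.Gamma (1 - α)) * Real.sqrt V * T ^ (-μ) + 1,
    by positivity, ?_⟩
  intro M hM U P hUP n hn hnM
  have hM' : (0 : ℝ) < M := by positivity
  have hmono : StrictMono (gradedTime T γ M) := gradedTime_strictMono hT hγ hM
  have hstab := exp_mul_dgNorm_sub_le m (ρ := C * Real.Gamma (1 - α) * (M : ℝ) ^ (-μ)) hT hγ hα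
    hκ hb (abs_nonneg _) hup hM
    (fun n hn hnM i j =>
      integrableOn_caputoSubst m hT hγ hα hδ2 hδ1 hκ hb hup.continuousOn hu hM hn hnM i j)
    (fun n hn hnM i j z hz => by
      refine (htr M n hM hn hnM i j z hz).trans ?_
      have h1 := rpow_div_Gamma_le_l1Coeff hα hmono (gradedTime_zero hγ M) hn
      rw [div_le_iff₀ hG] at h1
      calc C * gradedTime T γ M n ^ (-α) * (M : ℝ) ^ (-μ)
          ≤ C * (l1Coeff α (gradedTime T γ M) n (n - 1) * Real.Gamma (1 - α))
            * (M : ℝ) ^ (-μ) := by gcongr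
        _ = _ := by ring) hUP hnM
  set ρ := C * Real.Gamma (1 - α) * (M : ℝ) ^ (-μ)
  have hρ : 0 ≤ ρ := by positivity
  set d := dgNorm m (u (gradedTime T γ M n) - U n)
  rw [← mul_pow] at hstab
  have h1 : Real.exp (-b * gradedTime T γ M n) * d ≤ ρ * Real.sqrt V := by
    refine le_of_sq_le_sq ?_ (by positivity)
    rw [mul_pow ρ, Real.sq_sqrt hV]
    exact hstab
  have h2 : d ≤ Real.exp (b * T) * (ρ * Real.sqrt V) := by
    have h3 : Real.exp (b * gradedTime T γ M n) ≤ Real.exp (b * T) :=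
      Real.exp_le_exp.2 (mul_le_mul_of_nonneg_left (gradedTime_le hT hγ hM hnM) (abs_nonneg _))
    calc d = Real.exp (b * gradedTime T γ M n) * (Real.exp (-b * gradedTime T γ M n) * d) := by
          rw [← mul_assoc, ← Real.exp_add, neg_mul, add_neg_cancel, Real.exp_zero, one_mul]
      _ ≤ Real.exp (b * gradedTime T γ M n) * (ρ * Real.sqrt V) := by gcongr
      _ ≤ _ := by gcongr
  -- Passage from the number of steps to the maximal step, which is at least T/M.
  have h4 : (M : ℝ) ^ (-μ) ≤ T ^ (-μ) * maxStep T γ M ^ μ := by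
    have h5 : (T / M) ^ μ ≤ maxStep T γ M ^ μ :=
      Real.rpow_le_rpow (by positivity) (div_le_maxStep hγ hM) hμ.le
    calc (M : ℝ) ^ (-μ) = T ^ (-μ) * (T / M) ^ μ := by
          rw [Real.div_rpow hT.le hM'.le, Real.rpow_neg hT.le, Real.rpow_neg hM'.le]
          field_simp
      _ ≤ _ := by gcongr
  have h6 : 0 ≤ maxStep T γ M ^ μ :=
    Real.rpow_nonneg ((by positivity : 0 ≤ T / M).trans (div_le_maxStep hγ hM)) _
  calc d ≤ Real.exp (b * T) * (ρ * Real.sqrt V) := h2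
    _ = Real.exp (b * T) * (C * Real.Gamma (1 - α)) * Real.sqrt V * (M : ℝ) ^ (-μ) := by ring
    _ ≤ Real.exp (b * T) * (C * Real.Gamma (1 - α)) * Real.sqrt V
        * (T ^ (-μ) * maxStep T γ M ^ μ) := by gcongr
    _ ≤ _ := by nlinarith
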